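/- Let $p$ be a prime, let $d\ge 2$, and let $F$ be the free metabelian pro-$p$ group on generators $g_1,\dots,g_d$. Let $A=F'$ be the derived subgroup of $F$ (the closed subgroup generated by all commutators), put $x_i=g_iF'$ and $X=F/F'$, and let $R=\mathbb{Z}_p[[X]]=\varprojlim_{n,N}(\mathbb{Z}/p^n)[X/N]$ (where $n\in\mathbb{N}$ and $N$ runs over the open subgroups of $X$) be the completed group algebra of $X$. Write $A$ additively and regard it as an $R$-module through the continuous extension to $R$ of the conjugation action $a\cdot gF'=g^{-1}ag$ of $X$ on $A$. Put $\xi_d=x_d-1\in R$ and $u_{id}=[g_i,g_d]=g_i^{-1}g_d^{-1}g_ig_d\in A$ for $1\le i\le d-1$. Then the map $a\mapsto a\xi_d$ is an isomorphism of $R$-modules from $A$ onto $A\xi_d$, the elements $u_{1d},\dots,u_{d-1,d}$ are linearly independent over $R$ (so that the sum $\sum_{i=1}^{d-1}u_{id}R$ is direct and is a free $R$-module of rank $d-1$), and $$A\xi_d\ \le\ \bigoplus_{i=1}^{d-1}u_{id}R .$$ -/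

import Mathlib

open Topology

universe u

/-- A profinite (compact, Hausdorff, totally disconnected) group `G` is pro-`p` if every open
normal subgroup of `G` has index a power of `p`. -/
class IsProP (p : ℕ) (G : Type*) [Group G] [TopologicalSpace G] [IsTopologicalGroup G]
    [CompactSpace G] [T2Space G] [TotallyDisconnectedSpace G] : Prop where
  index_eq_pow : ∀ N : OpenNormalSubgroup G, ∃ k : ℕ, N.toSubgroup.index = p ^ k

/-- A metabelian group: the commutator subgroup is abelian. -/
class IsMetabelianGroup (G : Type*) [Group G] : Prop where
  commute : ∀ a ∈ commutator G, ∀ b ∈ commutator G, a * b = b * a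

/-- The metabelian pro-`p` group `F` is free, as such, on the finite family `g`: every map from
the family to a metabelian pro-`p` group extends uniquely to a continuous homomorphism. -/
structure IsFreeMetabelianProP (p : ℕ) {ι : Type*} [Finite ι] {F : Type u} [Group F]
    [TopologicalSpace F] [IsTopologicalGroup F] [CompactSpace F] [T2Space F]
    [TotallyDisconnectedSpace F] [IsProP p F] [IsMetabelianGroup F] (g : ι → F) : Prop where
  existsUnique_lift : ∀ (G : Type u) [Group G] [TopologicalSpace G] [IsTopologicalGroup G]
    [CompactSpace G] [T2Space G] [TotallyDisconnectedSpace G] [IsProP p G] [IsMetabelianGroup G]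
    (h : ι → G), ∃! φ : F →ₜ* G, ∀ i, φ (g i) = h i

noncomputable section

/-! ### The completed group algebra `ℤ_p[[X]]` -/

section CompletedGroupAlgebra

variable (p : ℕ) (X : Type*) [CommGroup X] [TopologicalSpace X]

/-- The finite-level group ring `(ℤ/pⁿ)[X/N]`. -/
abbrev LevelAlgebra (i : ℕ × OpenNormalSubgroup X) : Type _ :=
  MonoidAlgebra (ZMod (p ^ i.1)) (X ⧸ i.2.toSubgroup)

variable {X}

/-- The natural map `(ℤ/pᵐ)[X/M] → (ℤ/pⁿ)[X/N]` for `n ≤ m` and `M ≤ N`. -/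
def levelMap {i j : ℕ × OpenNormalSubgroup X} (hn : i.1 ≤ j.1) (hN : j.2 ≤ i.2) :
    LevelAlgebra p X j →+* LevelAlgebra p X i :=
  (MonoidAlgebra.mapRingHom _ (ZMod.castHom (pow_dvd_pow p hn) (ZMod (p ^ i.1)))).comp
    (MonoidAlgebra.mapDomainRingHom _
      (QuotientGroup.map j.2.toSubgroup i.2.toSubgroup (MonoidHom.id X) hN))

variable (X)

/-- The inverse limit of the rings `(ℤ/pⁿ)[X/N]`, over `n` and the open normal subgroups `N`
of `X`, inside their product. -/
def completedGroupAlgebraSubring : Subring (∀ i : ℕ × OpenNormalSubgroup X, LevelAlgebra p X i) where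
  carrier := {r | ∀ (i j : ℕ × OpenNormalSubgroup X) (hn : i.1 ≤ j.1) (hN : j.2 ≤ i.2),
    levelMap p hn hN (r j) = r i}
  mul_mem' hr hs i j hn hN := by
    rw [Pi.mul_apply, Pi.mul_apply, map_mul, hr i j hn hN, hs i j hn hN]
  one_mem' i j hn hN := by rw [Pi.one_apply, Pi.one_apply, map_one]
  add_mem' hr hs i j hn hN := by
    rw [Pi.add_apply, Pi.add_apply, map_add, hr i j hn hN, hs i j hn hN]
  zero_mem' i j hn hN := by rw [Pi.zero_apply, Pi.zero_apply, map_zero]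
  neg_mem' hr i j hn hN := by rw [Pi.neg_apply, Pi.neg_apply, map_neg, hr i j hn hN]

/-- The completed group algebra `ℤ_p[[X]]`. -/
abbrev CompletedGroupAlgebra : Type _ := completedGroupAlgebraSubring p X

variable {X}

/-- The natural map `ℤ[X] → (ℤ/pⁿ)[X/N]`. -/
def toLevel (i : ℕ × OpenNormalSubgroup X) : MonoidAlgebra ℤ X →+* LevelAlgebra p X i :=
  (MonoidAlgebra.mapRingHom _ (Int.castRingHom (ZMod (p ^ i.1)))).comp
    (MonoidAlgebra.mapDomainRingHom _ (QuotientGroup.mk' i.2.toSubgroup))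

lemma levelMap_toLevel {i j : ℕ × OpenNormalSubgroup X} (hn : i.1 ≤ j.1) (hN : j.2 ≤ i.2)
    (s : MonoidAlgebra ℤ X) : levelMap p hn hN (toLevel p j s) = toLevel p i s := by
  have : (levelMap p hn hN).comp (toLevel p j) = toLevel p i := by
    ext x
    · simp
    · have h1 : (QuotientGroup.map j.2.toSubgroup i.2.toSubgroup (MonoidHom.id X) hN)
          (QuotientGroup.mk x) = QuotientGroup.mk x := rfl
      simp only [levelMap, toLevel, MonoidHom.coe_comp, MonoidHom.coe_coe, RingHom.coe_comp,
        Function.comp_apply, MonoidAlgebra.of_apply, MonoidAlgebra.mapDomainRingHom_apply,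
        MonoidAlgebra.mapDomain_single, MonoidAlgebra.mapRingHom_single, map_one,
        QuotientGroup.mk'_apply, h1]
  exact DFunLike.congr_fun this s

/-- The natural map `ℤ[X] → ℤ_p[[X]]`. -/
def toCompleted : MonoidAlgebra ℤ X →+* CompletedGroupAlgebra p X :=
  (RingHom.pi fun i => toLevel p i).codRestrict (completedGroupAlgebraSubring p X)
    fun s _ _ hn hN => levelMap_toLevel p hn hN s

/-- The group elements `x ∈ X`, as elements of `ℤ_p[[X]]`. -/
def CompletedGroupAlgebra.of : X →* CompletedGroupAlgebra p X :=
  (toCompleted p).toMonoidHom.comp (MonoidAlgebra.of ℤ X)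

end CompletedGroupAlgebra

/-! ### The module structure over `ℤ_p[[X]]` -/

section ModuleStructure

section GroupRing

variable {X A : Type*} [CommGroup X] [AddCommGroup A] [DistribMulAction X A]

/-- The action of the abstract group ring `ℤ[X]` on an `X`-module. -/
def groupRingAct : MonoidAlgebra ℤ X →+* AddMonoid.End A :=
  (MonoidAlgebra.lift ℤ (AddMonoid.End A) X
    (DistribMulAction.toAddMonoidEnd X A)).toRingHom

lemma groupRingAct_single (x : X) (n : ℤ) (a : A) :
    groupRingAct (MonoidAlgebra.single x n) a = n • x • a := by
  have h : groupRingAct (MonoidAlgebra.single x n) =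
      n • DistribMulAction.toAddMonoidEnd X A x := by simp [groupRingAct]
  rw [h]
  rfl

lemma groupRingAct_add (s t : MonoidAlgebra ℤ X) (a : A) :
    groupRingAct (s + t) a = groupRingAct s a + groupRingAct t a := by
  rw [map_add]
  rfl

lemma groupRingAct_mul (s t : MonoidAlgebra ℤ X) (a : A) :
    groupRingAct (s * t) a = groupRingAct s (groupRingAct t a) := by
  rw [map_mul]
  rfl

lemma groupRingAct_mem {U : AddSubgroup A} (hU : ∀ (x : X), ∀ a ∈ U, x • a ∈ U)
    (s : MonoidAlgebra ℤ X) {a : A} (ha : a ∈ U) : groupRingAct s a ∈ U := by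
  induction s using MonoidAlgebra.induction_linear with
  | zero => simp
  | add f g hf hg => rw [groupRingAct_add]; exact U.add_mem hf hg
  | single x c => rw [groupRingAct_single]; exact U.zsmul_mem (hU x a ha) c

end GroupRing

variable (p : ℕ) (X A : Type*) [CommGroup X] [TopologicalSpace X] [AddCommGroup A]
  [TopologicalSpace A] [DistribMulAction X A]

/-- A pro-`p` `X`-module: the open `X`-invariant subgroups `U` such that `A / U` has `p`-power
exponent and such that some open subgroup of `X` acts trivially on `A / U` form a neighbourhood
base of `0`. -/
class IsProPModule : Prop where
  exists_subgroup : ∀ V ∈ 𝓝 (0 : A), ∃ U : AddSubgroup A, IsOpen (U : Set A) ∧ (U : Set A) ⊆ V ∧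
    (∀ (x : X), ∀ a ∈ U, x • a ∈ U) ∧ (∃ n : ℕ, ∀ a : A, p ^ n • a ∈ U) ∧
    ∃ N : OpenNormalSubgroup X, ∀ x ∈ N, ∀ a : A, x • a - a ∈ U

variable {X A}

/-- `b = r • a` for `r ∈ ℤ_p[[X]]`: the element `b` is the limit of the elements `s • a`, for
`s ∈ ℤ[X]` converging to `r` in `ℤ_p[[X]]`. -/
def IsLimitSMul (r : CompletedGroupAlgebra p X) (a b : A) : Prop :=
  ∀ V ∈ 𝓝 (0 : A), ∃ i : ℕ × OpenNormalSubgroup X, ∀ s : MonoidAlgebra ℤ X,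
    toLevel p i s = r.1 i → b - groupRingAct s a ∈ V

lemma toLevel_eq_of_le {i j : ℕ × OpenNormalSubgroup X} (hn : i.1 ≤ j.1) (hN : j.2 ≤ i.2)
    {r : CompletedGroupAlgebra p X} {s : MonoidAlgebra ℤ X} (h : toLevel p j s = r.1 j) :
    toLevel p i s = r.1 i := by
  rw [← levelMap_toLevel p hn hN, h, r.2 i j hn hN]

lemma toLevel_surjective (i : ℕ × OpenNormalSubgroup X) :
    Function.Surjective (toLevel (X := X) p i) := by
  intro t
  induction t using MonoidAlgebra.induction_linear with
  | zero => exact ⟨0, map_zero _⟩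
  | add f g hf hg =>
    obtain ⟨s, rfl⟩ := hf
    obtain ⟨t, rfl⟩ := hg
    exact ⟨s + t, map_add _ _ _⟩
  | single x c =>
    obtain ⟨x, rfl⟩ := QuotientGroup.mk_surjective x
    obtain ⟨c, rfl⟩ := ZMod.intCast_surjective c
    exact ⟨MonoidAlgebra.single x c, by simp [toLevel]⟩

lemma groupRingAct_mem_of_toLevel_eq_zero {U : AddSubgroup A}
    (hU : ∀ (x : X), ∀ a ∈ U, x • a ∈ U) {n : ℕ} (hn : ∀ a : A, p ^ n • a ∈ U)
    {N : OpenNormalSubgroup X} (hN : ∀ x ∈ N, ∀ a : A, x • a - a ∈ U)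
    {s : MonoidAlgebra ℤ X} (hs : toLevel p (n, N) s = 0) (a : A) : groupRingAct s a ∈ U := by
  classical
  let φ : (X ⧸ N.toSubgroup →₀ ℤ) →+ A :=
    Finsupp.liftAddHom fun c => (zmultiplesHom A) (Quotient.out c • a)
  let π : MonoidAlgebra ℤ X →+* MonoidAlgebra ℤ (X ⧸ N.toSubgroup) :=
    MonoidAlgebra.mapDomainRingHom ℤ (QuotientGroup.mk' N.toSubgroup)
  have h1 : ∀ s : MonoidAlgebra ℤ X, groupRingAct s a - φ (π s).coeff ∈ U := by
    intro s
    induction s using MonoidAlgebra.induction_linear with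
    | zero => simp
    | add f g hf hg =>
      have := U.add_mem hf hg
      rw [groupRingAct_add, map_add, MonoidAlgebra.coeff_add, map_add]
      convert this using 1
      abel
    | single x c =>
      have hx : (Quotient.out (QuotientGroup.mk x : X ⧸ N.toSubgroup))⁻¹ * x ∈ N := by
        have := QuotientGroup.out_eq' (QuotientGroup.mk x : X ⧸ N.toSubgroup)
        exact QuotientGroup.eq.mp this
      have h2 := hU (Quotient.out (QuotientGroup.mk x : X ⧸ N.toSubgroup)) _ (hN _ hx a)
      rw [smul_sub, smul_smul, mul_inv_cancel_left] at h2
      have h3 : φ (π (MonoidAlgebra.single x c)).coeff =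
          c • (Quotient.out (QuotientGroup.mk x : X ⧸ N.toSubgroup) • a) := by
        simp [φ, π]
      rw [groupRingAct_single, h3, ← smul_sub]
      exact U.zsmul_mem h2 c
  have h4 : ∀ c, ((p ^ n : ℕ) : ℤ) ∣ (π s).coeff c := by
    intro c
    rw [← ZMod.intCast_zmod_eq_zero_iff_dvd] 
    have : (toLevel p (n, N) s).coeff c = 0 := by rw [hs]; rfl
    simpa [toLevel, π] using this
  have h5 : φ (π s).coeff ∈ U := by
    simp only [φ, Finsupp.liftAddHom_apply]
    refine U.sum_mem fun c _ => ?_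
    obtain ⟨k, hk⟩ := h4 c
    rw [hk]
    have := U.zsmul_mem (hn (Quotient.out c • a)) k
    rw [← natCast_zsmul, smul_smul, mul_comm] at this
    simpa using this
  simpa using U.add_mem (h1 s) h5

lemma IsLimitSMul.exists_approx {r : CompletedGroupAlgebra p X} {a b : A}
    (hb : IsLimitSMul p r a b) {U : AddSubgroup A} (hU : IsOpen (U : Set A)) :
    ∃ i : ℕ × OpenNormalSubgroup X, ∀ s : MonoidAlgebra ℤ X,
      toLevel p i s = r.1 i → b - groupRingAct s a ∈ U :=
  hb _ (hU.mem_nhds U.zero_mem)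

variable [IsProPModule p X A]

variable (X) in
lemma exists_level (V : Set A) (hV : V ∈ 𝓝 (0 : A)) :
    ∃ (U : AddSubgroup A) (i : ℕ × OpenNormalSubgroup X), IsOpen (U : Set A) ∧ (U : Set A) ⊆ V ∧
      (∀ (x : X), ∀ a ∈ U, x • a ∈ U) ∧ ∀ s t : MonoidAlgebra ℤ X,
        toLevel p i s = toLevel p i t → ∀ a : A, groupRingAct s a - groupRingAct t a ∈ U := by
  obtain ⟨U, hU, hUV, hX, ⟨n, hn⟩, N, hN⟩ := IsProPModule.exists_subgroup (p := p) (X := X) V hV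
  refine ⟨U, (n, N), hU, hUV, hX, fun s t hst a => ?_⟩
  have := groupRingAct_mem_of_toLevel_eq_zero p hX hn hN (s := s - t)
    (by rw [map_sub, hst, sub_self]) a
  rwa [map_sub] at this

/-- Below any two levels there is a common one. -/
lemma exists_level_le (i j : ℕ × OpenNormalSubgroup X) :
    ∃ k : ℕ × OpenNormalSubgroup X, (i.1 ≤ k.1 ∧ k.2 ≤ i.2) ∧ (j.1 ≤ k.1 ∧ k.2 ≤ j.2) :=
  ⟨(max i.1 j.1, i.2 ⊓ j.2), ⟨le_max_left _ _, inf_le_left⟩, ⟨le_max_right _ _, inf_le_right⟩⟩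

/-- To check a limit it is enough to have one good approximation for every neighbourhood and
every level. -/
lemma isLimitSMul_of_exists {r : CompletedGroupAlgebra p X} {a b : A}
    (h : ∀ U : AddSubgroup A, IsOpen (U : Set A) → (∀ (x : X), ∀ a ∈ U, x • a ∈ U) →
      ∀ i : ℕ × OpenNormalSubgroup X, ∃ s : MonoidAlgebra ℤ X, toLevel p i s = r.1 i ∧
        b - groupRingAct s a ∈ U) : IsLimitSMul p r a b := by
  intro V hV
  obtain ⟨U, i, hU, hUV, hX, hi⟩ := exists_level p X V hV
  obtain ⟨s, hs, hb⟩ := h U hU hX i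
  refine ⟨i, fun t ht => hUV ?_⟩
  have := U.add_mem hb (hi s t (hs.trans ht.symm) a)
  rwa [sub_add_sub_cancel] at this

lemma IsLimitSMul.unique [T2Space A] {r : CompletedGroupAlgebra p X} {a b c : A}
    (hb : IsLimitSMul p r a b) (hc : IsLimitSMul p r a c) : b = c := by
  by_contra hne
  have hV : {b - c}ᶜ ∈ 𝓝 (0 : A) := isOpen_compl_singleton.mem_nhds
    (by simpa [eq_comm] using sub_ne_zero.mpr hne)
  obtain ⟨U, -, hU, hUV, -, -⟩ := exists_level p X _ hV
  obtain ⟨i, hi⟩ := hb.exists_approx p hU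
  obtain ⟨j, hj⟩ := hc.exists_approx p hU
  obtain ⟨k, hik, hjk⟩ := exists_level_le i j
  obtain ⟨s, hs⟩ := toLevel_surjective p k (r.1 k)
  have h := U.sub_mem (hi s (toLevel_eq_of_le p hik.1 hik.2 hs))
    (hj s (toLevel_eq_of_le p hjk.1 hjk.2 hs))
  rw [sub_sub_sub_cancel_right] at h
  exact hUV h rfl

lemma IsLimitSMul.add_left {r r' : CompletedGroupAlgebra p X} {a b b' : A}
    (hb : IsLimitSMul p r a b) (hb' : IsLimitSMul p r' a b') :
    IsLimitSMul p (r + r') a (b + b') := by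
  refine isLimitSMul_of_exists p fun U hU hX l => ?_
  obtain ⟨i, hi⟩ := hb.exists_approx p hU
  obtain ⟨j, hj⟩ := hb'.exists_approx p hU
  obtain ⟨k, hik, hjk⟩ := exists_level_le i j
  obtain ⟨m, hkm, hlm⟩ := exists_level_le k l
  obtain ⟨s, hs⟩ := toLevel_surjective p m (r.1 m)
  obtain ⟨t, ht⟩ := toLevel_surjective p m (r'.1 m)
  refine ⟨s + t, ?_, ?_⟩
  · rw [map_add, toLevel_eq_of_le p hlm.1 hlm.2 hs, toLevel_eq_of_le p hlm.1 hlm.2 ht]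
    rfl
  · have := U.add_mem
      (hi s (toLevel_eq_of_le p (hik.1.trans hkm.1) (hkm.2.trans hik.2) hs))
      (hj t (toLevel_eq_of_le p (hjk.1.trans hkm.1) (hkm.2.trans hjk.2) ht))
    rw [groupRingAct_add]
    convert this using 1
    abel

lemma IsLimitSMul.add_right {r : CompletedGroupAlgebra p X} {a a' b b' : A}
    (hb : IsLimitSMul p r a b) (hb' : IsLimitSMul p r a' b') :
    IsLimitSMul p r (a + a') (b + b') := by
  refine isLimitSMul_of_exists p fun U hU hX l => ?_
  obtain ⟨i, hi⟩ := hb.exists_approx p hU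
  obtain ⟨j, hj⟩ := hb'.exists_approx p hU
  obtain ⟨k, hik, hjk⟩ := exists_level_le i j
  obtain ⟨m, hkm, hlm⟩ := exists_level_le k l
  obtain ⟨s, hs⟩ := toLevel_surjective p m (r.1 m)
  refine ⟨s, toLevel_eq_of_le p hlm.1 hlm.2 hs, ?_⟩
  have := U.add_mem
    (hi s (toLevel_eq_of_le p (hik.1.trans hkm.1) (hkm.2.trans hik.2) hs))
    (hj s (toLevel_eq_of_le p (hjk.1.trans hkm.1) (hkm.2.trans hjk.2) hs))
  rw [map_add]
  convert this using 1
  abel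

lemma IsLimitSMul.mul {r r' : CompletedGroupAlgebra p X} {a b c : A}
    (hb : IsLimitSMul p r' a b) (hc : IsLimitSMul p r b c) : IsLimitSMul p (r * r') a c := by
  refine isLimitSMul_of_exists p fun U hU hX l => ?_
  obtain ⟨i, hi⟩ := hb.exists_approx p hU
  obtain ⟨j, hj⟩ := hc.exists_approx p hU
  obtain ⟨k, hik, hjk⟩ := exists_level_le i j
  obtain ⟨m, hkm, hlm⟩ := exists_level_le k l
  obtain ⟨s, hs⟩ := toLevel_surjective p m (r.1 m)
  obtain ⟨t, ht⟩ := toLevel_surjective p m (r'.1 m)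
  refine ⟨s * t, ?_, ?_⟩
  · rw [map_mul, toLevel_eq_of_le p hlm.1 hlm.2 hs, toLevel_eq_of_le p hlm.1 hlm.2 ht]
    rfl
  · have := U.add_mem
      (hj s (toLevel_eq_of_le p (hjk.1.trans hkm.1) (hkm.2.trans hjk.2) hs))
      (groupRingAct_mem hX s
        (hi t (toLevel_eq_of_le p (hik.1.trans hkm.1) (hkm.2.trans hik.2) ht)))
    rw [map_sub, sub_add_sub_cancel] at this
    rwa [groupRingAct_mul]

lemma isLimitSMul_toCompleted (s : MonoidAlgebra ℤ X) (a : A) :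
    IsLimitSMul p (toCompleted p s) a (groupRingAct s a) :=
  isLimitSMul_of_exists p fun U _ _ _ => ⟨s, rfl, by rw [sub_self]; exact U.zero_mem⟩

variable [IsTopologicalAddGroup A] [CompactSpace A]

lemma exists_isLimitSMul (r : CompletedGroupAlgebra p X) (a : A) :
    ∃ b : A, IsLimitSMul p r a b := by
  let I := {U : AddSubgroup A // IsOpen (U : Set A)}
  let C : (ℕ × OpenNormalSubgroup X) × I → Set A := fun q =>
    {b | ∃ s : MonoidAlgebra ℤ X, toLevel p q.1 s = r.1 q.1 ∧ b - groupRingAct s a ∈ q.2.1}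
  have hclosed : ∀ q, IsClosed (C q) := by
    intro q
    rw [← isOpen_compl_iff, isOpen_iff_mem_nhds]
    intro b hb
    have h0 : (fun c : A => b - c) ⁻¹' (q.2.1 : Set A) ∈ 𝓝 b := by
      have hc : Continuous fun c : A => b - c := by fun_prop
      refine hc.continuousAt.preimage_mem_nhds ?_
      rw [sub_self]
      exact q.2.2.mem_nhds q.2.1.zero_mem
    filter_upwards [h0] with c hc
    rintro ⟨s, hs, hcs⟩
    refine hb ⟨s, hs, ?_⟩
    have := q.2.1.add_mem hc hcs
    rwa [sub_add_sub_cancel] at this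
  have : Nonempty I := ⟨⟨⊤, isOpen_univ⟩⟩
  have : Nonempty (OpenNormalSubgroup X) := ⟨⟨⊤, inferInstance⟩⟩
  have hdir : Directed (· ⊇ ·) C := by
    rintro ⟨i, U⟩ ⟨j, V⟩
    obtain ⟨k, hik, hjk⟩ := exists_level_le i j
    refine ⟨(k, ⟨U.1 ⊓ V.1, U.2.inter V.2⟩), ?_, ?_⟩
    · rintro b ⟨s, hs, hb⟩
      exact ⟨s, toLevel_eq_of_le p hik.1 hik.2 hs, hb.1⟩
    · rintro b ⟨s, hs, hb⟩
      exact ⟨s, toLevel_eq_of_le p hjk.1 hjk.2 hs, hb.2⟩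
  have hne : ∀ q, (C q).Nonempty := by
    intro q
    obtain ⟨s, hs⟩ := toLevel_surjective p q.1 (r.1 q.1)
    exact ⟨groupRingAct s a, s, hs, by rw [sub_self]; exact q.2.1.zero_mem⟩
  obtain ⟨b, hb⟩ := IsCompact.nonempty_iInter_of_directed_nonempty_isCompact_isClosed C hdir hne
    (fun q => (hclosed q).isCompact) hclosed
  refine ⟨b, isLimitSMul_of_exists p fun U hU _ i => ?_⟩
  obtain ⟨s, hs, h⟩ := Set.mem_iInter.mp hb (i, ⟨U, hU⟩)
  exact ⟨s, hs, h⟩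

variable [T2Space A]

/-- The continuous extension to `ℤ_p[[X]]` of the action of `X` on a pro-`p` `X`-module. -/
instance (priority := 100) completedModule : Module (CompletedGroupAlgebra p X) A where
  smul r a := (exists_isLimitSMul p r a).choose
  one_smul a := (exists_isLimitSMul p 1 a).choose_spec.unique p (by
    have := isLimitSMul_toCompleted p (1 : MonoidAlgebra ℤ X) a
    rw [map_one, map_one] at this
    exact this)
  mul_smul r s a := (exists_isLimitSMul p (r * s) a).choose_spec.unique p
    ((exists_isLimitSMul p s a).choose_spec.mul p (exists_isLimitSMul p r _).choose_spec)
  smul_zero r := (exists_isLimitSMul p r (0 : A)).choose_spec.unique p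
    (isLimitSMul_of_exists p fun U _ _ i => by
      obtain ⟨s, hs⟩ := toLevel_surjective p i (r.1 i)
      exact ⟨s, hs, by rw [map_zero, sub_zero]; exact U.zero_mem⟩)
  smul_add r a b := (exists_isLimitSMul p r (a + b)).choose_spec.unique p
    ((exists_isLimitSMul p r a).choose_spec.add_right p (exists_isLimitSMul p r b).choose_spec)
  add_smul r s a := (exists_isLimitSMul p (r + s) a).choose_spec.unique p
    ((exists_isLimitSMul p r a).choose_spec.add_left p (exists_isLimitSMul p s a).choose_spec)
  zero_smul a := (exists_isLimitSMul p 0 a).choose_spec.unique p (by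
    have := isLimitSMul_toCompleted p (0 : MonoidAlgebra ℤ X) a
    rw [map_zero, map_zero] at this
    exact this)

lemma isLimitSMul_smul (r : CompletedGroupAlgebra p X) (a : A) : IsLimitSMul p r a (r • a) :=
  (exists_isLimitSMul p r a).choose_spec

lemma of_smul (x : X) (a : A) : CompletedGroupAlgebra.of p x • a = x • a := by
  refine (isLimitSMul_smul p _ a).unique p ?_
  have := isLimitSMul_toCompleted p (MonoidAlgebra.single x (1 : ℤ)) a
  rwa [groupRingAct_single, one_smul] at this

end ModuleStructure

/-! ### The derived subgroup as a module -/

section DerivedSubgroup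

open scoped commutatorElement

variable (F : Type*) [Group F] [TopologicalSpace F] [IsTopologicalGroup F]

/-- The derived subgroup of a topological group: the closed subgroup generated by the
commutators. -/
abbrev derivedSubgroup : Subgroup F := (commutator F).topologicalClosure

/-- The derived subgroup `A = F'`, written additively. -/
abbrev DerivedModule : Type _ := Additive (derivedSubgroup F)

/-- The ring `R = ℤ_p[[F / F']]`. -/
abbrev AbelianizedAlgebra (p : ℕ) : Type _ := CompletedGroupAlgebra p (TopologicalAbelianization F)

variable {F}

/-- The commutator `[a, b] = a⁻¹ b⁻¹ a b`, as an element of the derived subgroup written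
additively. -/
def derivedCommutator (a b : F) : DerivedModule F :=
  Additive.ofMul ⟨a⁻¹ * b⁻¹ * a * b, Subgroup.le_topologicalClosure _ (by
    have h : a⁻¹ * b⁻¹ * a * b = ⁅a⁻¹, b⁻¹⁆ := by simp [commutatorElement_def]
    rw [h]
    exact Subgroup.commutator_mem_commutator (Subgroup.mem_top _) (Subgroup.mem_top _))⟩

/-- Conjugation `a ↦ g⁻¹ a g` on the derived subgroup. -/
def derivedConj (g : F) (a : derivedSubgroup F) : derivedSubgroup F :=
  ⟨g⁻¹ * a * g, by
    have := (inferInstance : (derivedSubgroup F).Normal).conj_mem a a.2 g⁻¹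
    rwa [inv_inv] at this⟩

section Metabelian

variable [T2Space F] [IsMetabelianGroup F]

instance derivedSubgroup.commGroup : CommGroup (derivedSubgroup F) where
  mul_comm := ((commutator F).commGroupTopologicalClosure fun a b =>
    Subtype.ext (IsMetabelianGroup.commute (a : F) a.2 (b : F) b.2)).mul_comm
  __ : Group (derivedSubgroup F) := inferInstance

lemma derivedConj_eq {g h : F} (hgh : g⁻¹ * h ∈ derivedSubgroup F) (a : derivedSubgroup F) :
    derivedConj g a = derivedConj h a := by
  have h1 := congrArg Subtype.val (mul_comm (derivedConj g a) ⟨g⁻¹ * h, hgh⟩)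
  apply Subtype.ext
  simp only [derivedConj, Subgroup.coe_mul] at h1 ⊢
  have h2 : h⁻¹ * (a : F) * h = (g⁻¹ * h)⁻¹ * (g⁻¹ * a * g * (g⁻¹ * h)) := by group
  rw [h2, h1]
  group

/-- The action of `F / F'` on `F'` by `a ↦ g⁻¹ a g`; since `F / F'` is commutative, this right
action is also a left action. -/
instance derivedSubgroup.distribMulAction :
    DistribMulAction (TopologicalAbelianization F) (DerivedModule F) where
  smul x a := Quotient.liftOn' x (fun g => Additive.ofMul (derivedConj g a.toMul))
    fun _ _ h => congrArg _ (derivedConj_eq (QuotientGroup.leftRel_apply.mp h) _)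
  one_smul a := by
    apply Additive.toMul.injective
    apply Subtype.ext
    change (1 : F)⁻¹ * (a.toMul : F) * 1 = _
    group
  mul_smul x y a := by
    rw [mul_comm]
    induction x using QuotientGroup.induction_on with | H g => ?_
    induction y using QuotientGroup.induction_on with | H h => ?_
    apply Additive.toMul.injective
    apply Subtype.ext
    change (h * g)⁻¹ * (a.toMul : F) * (h * g) = g⁻¹ * (h⁻¹ * (a.toMul : F) * h) * g
    group
  smul_zero x := by
    induction x using QuotientGroup.induction_on with | H g => ?_
    apply Additive.toMul.injective
    apply Subtype.ext
    change g⁻¹ * (1 : F) * g = 1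
    group
  smul_add x a b := by
    induction x using QuotientGroup.induction_on with | H g => ?_
    apply Additive.toMul.injective
    apply Subtype.ext
    change g⁻¹ * ((a.toMul : F) * (b.toMul : F)) * g =
      (g⁻¹ * (a.toMul : F) * g) * (g⁻¹ * (b.toMul : F) * g)
    group

lemma derivedSubgroup.mk_smul (g : F) (a : derivedSubgroup F) :
    (QuotientGroup.mk g : TopologicalAbelianization F) • Additive.ofMul a =
      Additive.ofMul (derivedConj g a) := rfl

end Metabelian

variable (p : ℕ) [CompactSpace F] [T2Space F] [TotallyDisconnectedSpace F] [IsProP p F]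
  [IsMetabelianGroup F]

instance derivedSubgroup.compactSpace : CompactSpace (DerivedModule F) :=
  isCompact_iff_compactSpace.mp (Subgroup.isClosed_topologicalClosure (commutator F)).isCompact

instance derivedSubgroup.isProPModule :
    IsProPModule p (TopologicalAbelianization F) (DerivedModule F) where
  exists_subgroup V hV := by
    have hV' : V ∈ 𝓝 (1 : derivedSubgroup F) := hV
    obtain ⟨W, hW, hWV⟩ := mem_nhds_subtype _ _ _ |>.mp hV'
    obtain ⟨O, hOW, hO, hO1⟩ := mem_nhds_iff.mp hW
    obtain ⟨N, hN⟩ := ProfiniteGrp.exist_openNormalSubgroup_sub_open_nhds_of_one hO hO1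
    have hopen : IsOpen ((QuotientGroup.mk : F → TopologicalAbelianization F) '' N) :=
      QuotientGroup.isOpenMap_coe _ N.isOpen'
    refine ⟨(N.toSubgroup.subgroupOf (derivedSubgroup F)).toAddSubgroup, ?_, ?_, ?_, ?_, ?_⟩
    · exact N.isOpen'.preimage continuous_subtype_val
    · exact fun a ha => hWV (hOW (hN ha))
    · intro x a ha
      induction x using QuotientGroup.induction_on with | H g => ?_
      have := N.isNormal'.conj_mem _ ha g⁻¹
      rw [inv_inv] at this
      exact this
    · obtain ⟨k, hk⟩ := IsProP.index_eq_pow (p := p) N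
      refine ⟨k, fun a => ?_⟩
      have := Subgroup.pow_index_mem N.toSubgroup (a.toMul : F)
      rw [hk] at this
      exact this
    · refine ⟨⟨⟨N.toSubgroup.map (QuotientGroup.mk' _), hopen⟩,
        N.isNormal'.map _ (QuotientGroup.mk'_surjective _)⟩, ?_⟩
      rintro _ ⟨g, hg, rfl⟩ a
      have h1 := N.isNormal'.conj_mem _ hg (a.toMul : F)
      have h2 := N.toSubgroup.mul_mem (N.toSubgroup.inv_mem hg) h1
      have h3 : g⁻¹ * (a.toMul * g * (a.toMul : F)⁻¹) = g⁻¹ * a.toMul * g / (a.toMul : F) := by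
        rw [div_eq_mul_inv]
        group
      rw [h3] at h2
      exact h2

/-- The element `ξ = x - 1` of `R`, where `x = gF'`. -/
def xiElement (g : F) : AbelianizedAlgebra F p :=
  CompletedGroupAlgebra.of p (QuotientGroup.mk g : TopologicalAbelianization F) - 1

/-- The submodule `Aξ` of all multiples `aξ`, `a ∈ A`, where `ξ = gF' - 1`. -/
def xiMultiples (g : F) : Submodule (AbelianizedAlgebra F p) (DerivedModule F) :=
  LinearMap.range (LinearMap.lsmul (AbelianizedAlgebra F p) (DerivedModule F) (xiElement p g))

/-- The elements `u_{id} = [g_i, g_d]` of `A`, for the indices `i` other than the last one. -/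
def lastCommutators {d : ℕ} (hd : 2 ≤ d) (g : Fin d → F) (i : Fin (d - 1)) : DerivedModule F :=
  derivedCommutator (g (i.castLE (Nat.sub_le d 1))) (g ⟨d - 1, by omega⟩)

end DerivedSubgroup

end

/-! The proof rests on the Magnus embedding in the language of Fox derivatives. For each generator
there is a continuous derivation D_k : F → R with D_k(xy) = D_k(x)·y + D_k(y) and D_k(g_j) = δ_jk.
On A = F' the D_k are R-linear, and D_k[g_i, g_j] = ξ_j δ_ik − ξ_i δ_jk. Two facts carry the
argument: the D_k together are injective on A (`eq_zero_of_foxLinearMap_eq_zero`), and each ξ_j is a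
non-zero-divisor in R (`eq_zero_of_xiElement_mul_eq_zero`).

Hence A lies in a free R-module on which ξ_d acts injectively, so a ↦ aξ_d is injective. Applying
D_k to a relation Σ c_i u_id = 0 leaves c_k ξ_d = 0, so the u_id are independent. Comparing Fox
derivatives also gives the Hall–Witt identity ξ_d[g_i, g_j] = ξ_j u_id − ξ_i u_jd, whose right side
lies in U = Σ u_id R. Since R is compact, U is closed; the [g_i, g_j] generate A topologically as an
R-module, so Aξ_d ≤ U.

Everything is built at the finite levels (ℤ/pⁿ)[X/N], so freeness is only ever tested against finite
metabelian p-groups. A derivation is the translation part of a homomorphism to an affine group, and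
the levels fit together because a derivation is determined by its values on the generators. -/

section Lifts

/-! ### Finite metabelian p-groups as test objects for freeness -/

lemma isProP_of_isPGroup {p : ℕ} [Fact p.Prime] {G : Type*} [Group G] [TopologicalSpace G]
    [IsTopologicalGroup G] [CompactSpace G] [T2Space G] [TotallyDisconnectedSpace G] [Finite G]
    (h : IsPGroup p G) : IsProP p G where
  index_eq_pow N := h.index N.toSubgroup

lemma IsMetabelianGroup.of_injective {G H : Type*} [Group G] [Group H] [IsMetabelianGroup H]
    (f : G →* H) (hf : Function.Injective f) : IsMetabelianGroup G where
  commute a ha b hb := by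
    have h : (commutator G).map f ≤ commutator H := by
      rw [commutator_def, Subgroup.map_commutator]
      exact Subgroup.commutator_mono le_top le_top
    apply hf
    rw [map_mul, map_mul]
    exact IsMetabelianGroup.commute _ (h ⟨a, ha, rfl⟩) _ (h ⟨b, hb, rfl⟩)

lemma IsMetabelianGroup.of_surjective {G H : Type*} [Group G] [Group H] [IsMetabelianGroup G]
    (f : G →* H) (hf : Function.Surjective f) : IsMetabelianGroup H where
  commute a ha b hb := by
    have h : commutator H = (commutator G).map f := by
      rw [commutator_def, commutator_def, Subgroup.map_commutator, ← MonoidHom.range_eq_map,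
        MonoidHom.range_eq_top.mpr hf]
    rw [h] at ha hb
    obtain ⟨a, ha, rfl⟩ := ha
    obtain ⟨b, hb, rfl⟩ := hb
    rw [← map_mul, ← map_mul, IsMetabelianGroup.commute a ha b hb]

lemma IsMetabelianGroup.of_comm (G : Type*) [CommGroup G] : IsMetabelianGroup G where
  commute a _ b _ := mul_comm a b

/-- Allows continuity to be recorded as a condition on the kernel, so that later statements put no
topology on a finite target. -/
lemma MonoidHom.continuous_of_ker_mem_nhds {G H : Type*} [Group G] [TopologicalSpace G]
    [IsTopologicalGroup G] [Group H] [TopologicalSpace H] [IsTopologicalGroup H]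
    (f : G →* H) (h : (f.ker : Set G) ∈ 𝓝 1) : Continuous f := by
  refine continuous_of_continuousAt_one f ?_
  have h1 : f =ᶠ[𝓝 1] fun _ => 1 := by
    filter_upwards [h] with x hx using hx
  exact continuousAt_const.congr h1.symm

lemma OpenNormalSubgroup.isPGroup_quotient {p : ℕ} {F : Type*} [Group F] [TopologicalSpace F]
    [IsTopologicalGroup F] [CompactSpace F] [T2Space F] [TotallyDisconnectedSpace F] [IsProP p F]
    (N : OpenNormalSubgroup F) : IsPGroup p (F ⧸ N.toSubgroup) := by
  obtain ⟨k, hk⟩ := IsProP.index_eq_pow (p := p) N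
  exact IsPGroup.of_card (n := k) hk

namespace IsFreeMetabelianProP

variable {p : ℕ} [Fact p.Prime] {ι : Type*} [Finite ι] {F : Type u} [Group F]
  [TopologicalSpace F] [IsTopologicalGroup F] [CompactSpace F] [T2Space F]
  [TotallyDisconnectedSpace F] [IsProP p F] [IsMetabelianGroup F] {g : ι → F}

/-- Lifting to finite `p`-groups, without topologies on the target. -/
lemma exists_hom (hg : IsFreeMetabelianProP p g) {G : Type u} [Group G] [Finite G]
    [IsMetabelianGroup G] (hG : IsPGroup p G) (h : ι → G) :
    ∃ φ : F →* G, (φ.ker : Set F) ∈ 𝓝 1 ∧ ∀ i, φ (g i) = h i := by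
  let : TopologicalSpace G := ⊥
  have : DiscreteTopology G := ⟨rfl⟩
  have := isProP_of_isPGroup hG
  obtain ⟨φ, hφ, -⟩ := hg.existsUnique_lift G h
  refine ⟨φ.toMonoidHom, ?_, hφ⟩
  exact ((isOpen_discrete ({1} : Set G)).preimage φ.continuous_toFun).mem_nhds (map_one φ)

lemma hom_ext (hg : IsFreeMetabelianProP p g) {G : Type u} [Group G] [Finite G]
    [IsMetabelianGroup G] (hG : IsPGroup p G) {φ ψ : F →* G} (hφ : (φ.ker : Set F) ∈ 𝓝 1)
    (hψ : (ψ.ker : Set F) ∈ 𝓝 1) (h : ∀ i, φ (g i) = ψ (g i)) : φ = ψ := by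
  let : TopologicalSpace G := ⊥
  have : DiscreteTopology G := ⟨rfl⟩
  have := isProP_of_isPGroup hG
  have := (hg.existsUnique_lift G fun i => ψ (g i)).unique
    (y₁ := ⟨φ, φ.continuous_of_ker_mem_nhds hφ⟩) (y₂ := ⟨ψ, ψ.continuous_of_ker_mem_nhds hψ⟩)
    h fun _ => rfl
  exact congrArg ContinuousMonoidHom.toMonoidHom this

/-- An open subgroup containing the free generators is the whole group. -/
lemma mem_of_isOpen (hg : IsFreeMetabelianProP p g) {S : Subgroup F} (hS : (S : Set F) ∈ 𝓝 1)
    (h : ∀ i, g i ∈ S) (x : F) : x ∈ S := by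
  have hSo : IsOpen (S : Set F) := S.isOpen_of_mem_nhds hS
  obtain ⟨N, hN⟩ := ProfiniteGrp.exist_openNormalSubgroup_sub_open_nhds_of_one hSo S.one_mem
  have hNP : IsPGroup p (F ⧸ N.toSubgroup) := N.isPGroup_quotient
  have : Finite (F ⧸ N.toSubgroup) := N.toSubgroup.quotient_finite_of_isOpen N.isOpen'
  have : IsMetabelianGroup (F ⧸ N.toSubgroup) :=
    .of_surjective (QuotientGroup.mk' _) (QuotientGroup.mk'_surjective _)
  -- The image K of S in F/N is again a finite metabelian p-group. Lifting the generators into K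
  -- gives a map F → K ≤ F/N that agrees with the projection on generators, hence everywhere, so SN
  -- = F; and N ⊆ S.
  let K := S.map (QuotientGroup.mk' N.toSubgroup)
  have : IsMetabelianGroup K := .of_injective K.subtype K.subtype_injective
  obtain ⟨φ, hφ, hφg⟩ := hg.exists_hom (hNP.to_subgroup K)
    fun i => ⟨QuotientGroup.mk' _ (g i), g i, h i, rfl⟩
  have heq : K.subtype.comp φ = QuotientGroup.mk' N.toSubgroup := by
    refine hg.hom_ext hNP ?_ ?_ fun i => ?_
    · filter_upwards [hφ] with y hy
      have hy' : φ y = 1 := hy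
      change K.subtype (φ y) = 1
      rw [hy', map_one]
    · rw [QuotientGroup.ker_mk']
      exact N.isOpen'.mem_nhds N.one_mem'
    · simp [hφg]
  have h1 := DFunLike.congr_fun heq x
  obtain ⟨y, hy, hyx⟩ := (φ x).2
  have h2 : QuotientGroup.mk' N.toSubgroup y = QuotientGroup.mk' N.toSubgroup x := hyx.trans h1
  have h3 := QuotientGroup.eq.mp h2
  simpa using S.mul_mem hy (hN h3)

/-- A closed subgroup containing the free generators is the whole group. -/
lemma mem_of_isClosed (hg : IsFreeMetabelianProP p g) {S : Subgroup F} (hS : IsClosed (S : Set F))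
    (h : ∀ i, g i ∈ S) (x : F) : x ∈ S := by
  by_contra hx
  -- N is chosen so that Nx misses S, whereas the open subgroup NS contains the generators and
  -- therefore x.
  obtain ⟨N, hN⟩ := ProfiniteGrp.exist_openNormalSubgroup_sub_open_nhds_of_one
    (hS.isOpen_compl.preimage (continuous_mul_const x)) (by simpa using hx)
  have h1 := hg.mem_of_isOpen (S := N.toSubgroup ⊔ S)
    (Filter.mem_of_superset (N.isOpen'.mem_nhds N.one_mem')
      (show (N.toSubgroup : Set F) ⊆ _ from SetLike.coe_subset_coe.mpr le_sup_left))
    (fun i => le_sup_right (a := N.toSubgroup) (h i)) x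
  obtain ⟨y, hy, z, hz, hyz⟩ := Subgroup.mem_sup_of_normal_left.mp h1
  refine hN (N.toSubgroup.inv_mem hy) ?_
  have : y⁻¹ * x = z := by rw [← hyz]; group
  simpa [this] using hz

end IsFreeMetabelianProP

end Lifts

noncomputable section

/-! ### Affine groups -/

section AffineGroup

/-- The semidirect product of `Q` with the additive group of a ring `Λ` on which `Q` acts
through `χ`, that is, the group of matrices `(χ x, 0; v, 1)`. -/
@[ext]
structure AffineGroup {Q Λ : Type*} [CommGroup Q] [CommRing Λ] (χ : Q →* Λ) where
  /-- The linear part. -/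
  base : Q
  /-- The translation part. -/
  vec : Λ

namespace AffineGroup

variable {Q Λ : Type*} [CommGroup Q] [CommRing Λ] {χ : Q →* Λ}

/-- With this order of factors, the translation part of a homomorphism into the group obeys the
product rule of `IsFoxDerivation`. -/
instance : Mul (AffineGroup χ) := ⟨fun a b => ⟨a.base * b.base, χ b.base * a.vec + b.vec⟩⟩

instance : One (AffineGroup χ) := ⟨⟨1, 0⟩⟩

instance : Inv (AffineGroup χ) := ⟨fun a => ⟨a.base⁻¹, -(χ a.base⁻¹ * a.vec)⟩⟩

@[simp] lemma base_mul (a b : AffineGroup χ) : (a * b).base = a.base * b.base := rfl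

@[simp] lemma vec_mul (a b : AffineGroup χ) : (a * b).vec = χ b.base * a.vec + b.vec := rfl

@[simp] lemma base_one : (1 : AffineGroup χ).base = 1 := rfl

@[simp] lemma vec_one : (1 : AffineGroup χ).vec = 0 := rfl

@[simp] lemma base_inv (a : AffineGroup χ) : a⁻¹.base = a.base⁻¹ := rfl

@[simp] lemma vec_inv (a : AffineGroup χ) : a⁻¹.vec = -(χ a.base⁻¹ * a.vec) := rfl

instance : Group (AffineGroup χ) :=
  Group.ofLeftAxioms
    (fun a b c => by
      ext
      · simp [mul_assoc]
      · simp only [vec_mul, base_mul, map_mul]; ring)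
    (fun a => by ext <;> simp)
    (fun a => by
      ext
      · simp
      · simp only [vec_mul, vec_inv, vec_one, mul_neg]
        rw [← mul_assoc, ← map_mul, mul_inv_cancel, map_one, one_mul, neg_add_cancel])

/-- The projection to the linear part. -/
def baseHom (χ : Q →* Λ) : AffineGroup χ →* Q where
  toFun := base
  map_one' := rfl
  map_mul' _ _ := rfl

instance : IsMetabelianGroup (AffineGroup χ) where
  commute a ha b hb := by
    have h := Abelianization.commutator_subset_ker (baseHom χ)
    have ha' : a.base = 1 := h ha
    have hb' : b.base = 1 := h hb
    ext
    · simp [mul_comm]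
    · simp [ha', hb', add_comm]

instance [Finite Q] [Finite Λ] : Finite (AffineGroup χ) :=
  Finite.of_injective (fun a => (a.base, a.vec)) fun a b h => by
    ext
    · exact congrArg Prod.fst h
    · exact congrArg Prod.snd h

/-- Some p-power of an element has trivial linear part; it is then a translation, and `p ^ n` kills
translations. -/
lemma isPGroup {p n : ℕ} (hQ : IsPGroup p Q) (hΛ : ((p ^ n : ℕ) : Λ) = 0) :
    IsPGroup p (AffineGroup χ) := by
  intro a
  obtain ⟨k, hk⟩ := hQ a.base
  refine ⟨k + n, ?_⟩
  rw [pow_add, pow_mul]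
  have hb : (a ^ p ^ k).base = 1 := by
    rw [← hk]
    exact map_pow (baseHom χ) a _
  generalize a ^ p ^ k = c at hb ⊢
  have hc : ∀ m : ℕ, (c ^ m).base = 1 ∧ (c ^ m).vec = m * c.vec := by
    intro m
    induction m with
    | zero => simp
    | succ m ih =>
      rw [pow_succ]
      refine ⟨by simp [ih.1, hb], ?_⟩
      rw [vec_mul, hb, map_one, one_mul, ih.2]
      push_cast
      ring
  ext
  · exact (hc _).1
  · rw [(hc _).2, hΛ, zero_mul, vec_one]

end AffineGroup

end AffineGroup

/-! ### Fox derivations -/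

section Fox

variable {F : Type u} [Group F] [TopologicalSpace F] [IsTopologicalGroup F] (p : ℕ)

/-- The natural map from `F` to the group ring `(ℤ/pⁿ)[X/N]`, where `X = F/F'`. -/
def levelOf (i : ℕ × OpenNormalSubgroup (TopologicalAbelianization F)) :
    F →* LevelAlgebra p (TopologicalAbelianization F) i :=
  (MonoidAlgebra.of (ZMod (p ^ i.1)) (TopologicalAbelianization F ⧸ i.2.toSubgroup)).comp
    ((QuotientGroup.mk' i.2.toSubgroup).comp (QuotientGroup.mk' (derivedSubgroup F)))

variable {p}

lemma toLevel_single (i : ℕ × OpenNormalSubgroup (TopologicalAbelianization F)) (x : F) (n : ℤ) :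
    toLevel p i (MonoidAlgebra.single (QuotientGroup.mk x : TopologicalAbelianization F) n) =
      n • levelOf p i x := by
  simp [toLevel, levelOf, MonoidAlgebra.smul_single]

lemma levelMap_levelOf {i j : ℕ × OpenNormalSubgroup (TopologicalAbelianization F)}
    (hn : i.1 ≤ j.1) (hN : j.2 ≤ i.2) (x : F) :
    levelMap p hn hN (levelOf p j x) = levelOf p i x := by
  have h := levelMap_toLevel p hn hN
    (MonoidAlgebra.single (QuotientGroup.mk x : TopologicalAbelianization F) 1)
  simpa only [toLevel_single, one_smul] using h

lemma levelOf_eq_one (i : ℕ × OpenNormalSubgroup (TopologicalAbelianization F)) {x : F}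
    (hx : x ∈ derivedSubgroup F) : levelOf p i x = 1 := by
  have h : QuotientGroup.mk' (derivedSubgroup F) x = 1 := (QuotientGroup.eq_one_iff x).mpr hx
  simp only [levelOf, MonoidHom.comp_apply, h, map_one]

lemma xiElement_val (x : F) [CompactSpace F] [T2Space F] [TotallyDisconnectedSpace F]
    [IsProP p F] [IsMetabelianGroup F]
    (i : ℕ × OpenNormalSubgroup (TopologicalAbelianization F)) :
    (xiElement p x).1 i = levelOf p i x - 1 := by
  have h := toLevel_single (p := p) i x 1
  rw [one_smul] at h
  rw [← h]
  rfl

/-- Continuous derivations `D : F → (ℤ/pⁿ)[X/N]`, satisfying `D(xy) = D(x)y + D(y)`. -/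
structure IsFoxDerivation {i : ℕ × OpenNormalSubgroup (TopologicalAbelianization F)}
    (D : F → LevelAlgebra p (TopologicalAbelianization F) i) : Prop where
  map_mul : ∀ x y, D (x * y) = levelOf p i y * D x + D y
  eventually : ∀ᶠ x in 𝓝 1, D x = 0

namespace IsFoxDerivation

variable {i : ℕ × OpenNormalSubgroup (TopologicalAbelianization F)}
  {D : F → LevelAlgebra p (TopologicalAbelianization F) i}

lemma map_one (hD : IsFoxDerivation D) : D 1 = 0 := by
  simpa using hD.map_mul 1 1

lemma levelOf_mul_map_inv (hD : IsFoxDerivation D) (x : F) :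
    levelOf p i x * D x⁻¹ = - D x := by
  have h := hD.map_mul x⁻¹ x
  rw [inv_mul_cancel, hD.map_one] at h
  exact eq_neg_of_add_eq_zero_left h.symm

/-- The terms coming from x⁻¹ and x cancel. This is the X-equivariance of D on F', from which
R-linearity follows. -/
lemma map_conj (hD : IsFoxDerivation D) (x : F) {a : F} (ha : a ∈ derivedSubgroup F) :
    D (x⁻¹ * a * x) = levelOf p i x * D a := by
  rw [hD.map_mul, hD.map_mul, levelOf_eq_one i ha, one_mul, mul_add, hD.levelOf_mul_map_inv]
  ring

/-- Expand D on both sides of yx·[x, y] = xy, using that [x, y] acts trivially; no derivative of an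
inverse is needed. -/
lemma map_commutator (hD : IsFoxDerivation D) (x y : F) :
    D (x⁻¹ * y⁻¹ * x * y) = (levelOf p i y - 1) * D x - (levelOf p i x - 1) * D y := by
  have h1 := hD.map_mul (y * x) (x⁻¹ * y⁻¹ * x * y)
  have h2 : y * x * (x⁻¹ * y⁻¹ * x * y) = x * y := by group
  have h3 : levelOf p i (x⁻¹ * y⁻¹ * x * y) = 1 := levelOf_eq_one i (derivedCommutator x y).toMul.2
  rw [h2, hD.map_mul, hD.map_mul, h3] at h1
  linear_combination -h1

lemma levelMap {j : ℕ × OpenNormalSubgroup (TopologicalAbelianization F)}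
    (hn : j.1 ≤ i.1) (hN : i.2 ≤ j.2) (hD : IsFoxDerivation D) :
    IsFoxDerivation (fun x => levelMap p hn hN (D x)) where
  map_mul x y := by
    rw [hD.map_mul, _root_.map_add, _root_.map_mul, levelMap_levelOf]
  eventually := by
    filter_upwards [hD.eventually] with x hx
    rw [hx, map_zero]

end IsFoxDerivation

end Fox

/-! ### Finiteness of the levels -/

section FiniteLevels

variable {F : Type u} [Group F] [TopologicalSpace F] [IsTopologicalGroup F] [CompactSpace F]

instance finite_quotient_abelianization (N : OpenNormalSubgroup (TopologicalAbelianization F)) :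
    Finite (TopologicalAbelianization F ⧸ N.toSubgroup) :=
  N.toSubgroup.quotient_finite_of_isOpen N.isOpen'

instance finite_levelAlgebra {p : ℕ} [Fact p.Prime]
    (i : ℕ × OpenNormalSubgroup (TopologicalAbelianization F)) :
    Finite (LevelAlgebra p (TopologicalAbelianization F) i) := by
  have : NeZero (p ^ i.1) := ⟨pow_ne_zero _ (Fact.out : p.Prime).ne_zero⟩
  exact Finite.of_injective (fun f => ⇑f.coeff)
    (DFunLike.coe_injective.comp MonoidAlgebra.coeff_injective)

/-- The preimage in `F` of an open subgroup of `F/F'`. -/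
def OpenNormalSubgroup.preimageMk (N : OpenNormalSubgroup (TopologicalAbelianization F)) : OpenNormalSubgroup F where
  toSubgroup := N.toSubgroup.comap (QuotientGroup.mk' _)
  isOpen' := N.isOpen'.preimage QuotientGroup.continuous_mk
  isNormal' := N.isNormal'.comap _

lemma isPGroup_quotient_abelianization {p : ℕ} [T2Space F]
    [TotallyDisconnectedSpace F] [IsProP p F] (N : OpenNormalSubgroup (TopologicalAbelianization F)) :
    IsPGroup p (TopologicalAbelianization F ⧸ N.toSubgroup) := by
  obtain ⟨k, hk⟩ := IsProP.index_eq_pow (p := p) N.preimageMk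
  refine IsPGroup.of_card (n := k) (Eq.trans ?_ hk)
  exact (Subgroup.index_comap_of_surjective _ (QuotientGroup.mk'_surjective _)).symm

end FiniteLevels

/-! ### Existence, uniqueness and linearity of the Fox derivatives -/

namespace IsFreeMetabelianProP

variable {p : ℕ} [Fact p.Prime] {ι : Type*} [Finite ι] {F : Type u} [Group F]
  [TopologicalSpace F] [IsTopologicalGroup F] [CompactSpace F] [T2Space F]
  [TotallyDisconnectedSpace F] [IsProP p F] [IsMetabelianGroup F] {g : ι → F}

/-- Two crossed homomorphisms which agree near `1` and on the free generators are equal. -/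
lemma crossedHom_ext (hg : IsFreeMetabelianProP p g) {Q M : Type*} [Group Q] [AddCommGroup M]
    (π : F →* Q) {T K : F → Q → M} (hT : ∀ x y q, T (x * y) q = T x (π y * q) + T y q)
    (hK : ∀ x y q, K (x * y) q = K x (π y * q) + K y q) (h1 : ∀ᶠ x in 𝓝 1, ∀ q, T x q = K x q)
    (h : ∀ j q, T (g j) q = K (g j) q) (x : F) (q : Q) : T x q = K x q := by
  have one : ∀ {L : F → Q → M}, (∀ x y q, L (x * y) q = L x (π y * q) + L y q) →
      ∀ q, L 1 q = 0 := fun hL q => by simpa using hL 1 1 q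
  have inv : ∀ {L : F → Q → M}, (∀ x y q, L (x * y) q = L x (π y * q) + L y q) →
      ∀ x q, L x⁻¹ q = -L x ((π x)⁻¹ * q) := fun hL x q => by
    have h := hL x⁻¹ x ((π x)⁻¹ * q)
    rw [inv_mul_cancel, one hL, mul_inv_cancel_left] at h
    exact eq_neg_of_add_eq_zero_left h.symm
  -- Agreement is required for all q at once, because the product rule shifts q by π y. The
  -- resulting subgroup is a neighbourhood of 1 containing the generators.
  let S : Subgroup F :=
    { carrier := {x | ∀ q, T x q = K x q}
      mul_mem' := fun {x y} hx hy q => by rw [hT, hK, hx, hy]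
      one_mem' := fun q => by rw [one hT, one hK]
      inv_mem' := fun {x} hx q => by rw [inv hT, inv hK, hx] }
  exact hg.mem_of_isOpen (S := S) h1 h x q

/-- Carrying a multiplier q ∈ F along turns D into the crossed homomorphism `levelOf p i q * D x`; q
= 1 recovers D. -/
lemma foxDerivation_ext (hg : IsFreeMetabelianProP p g)
    {i : ℕ × OpenNormalSubgroup (TopologicalAbelianization F)}
    {D D' : F → LevelAlgebra p (TopologicalAbelianization F) i}
    (hD : IsFoxDerivation D) (hD' : IsFoxDerivation D') (h : ∀ j, D (g j) = D' (g j)) :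
    D = D' := by
  have key : ∀ {E : F → LevelAlgebra p (TopologicalAbelianization F) i}, IsFoxDerivation E →
      ∀ x y q, levelOf p i q * E (x * y) = levelOf p i (y * q) * E x + levelOf p i q * E y :=
    fun hE x y q => by rw [hE.map_mul, map_mul]; ring
  funext x
  have := hg.crossedHom_ext (MonoidHom.id F) (T := fun x q => levelOf p i q * D x)
    (K := fun x q => levelOf p i q * D' x) (key hD) (key hD') ?_ (fun j q => by rw [h]) x 1
  · simpa using this
  · filter_upwards [hD.eventually, hD'.eventually] with y hy hy' q
    rw [hy, hy']

/-- Freeness gives a homomorphism to the affine group sending g_j to (π(g_j), c_j). Its linear part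
is π by uniqueness, so its translation part is the desired derivation. -/
lemma exists_foxDerivation (hg : IsFreeMetabelianProP p g)
    (i : ℕ × OpenNormalSubgroup (TopologicalAbelianization F))
    (c : ι → LevelAlgebra p (TopologicalAbelianization F) i) :
    ∃ D : F → LevelAlgebra p (TopologicalAbelianization F) i,
      IsFoxDerivation D ∧ ∀ j, D (g j) = c j := by
  let χ := MonoidAlgebra.of (ZMod (p ^ i.1)) (TopologicalAbelianization F ⧸ i.2.toSubgroup)
  let π : F →* TopologicalAbelianization F ⧸ i.2.toSubgroup :=
    (QuotientGroup.mk' i.2.toSubgroup).comp (QuotientGroup.mk' (derivedSubgroup F))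
  have hQ := isPGroup_quotient_abelianization (p := p) i.2
  have := IsMetabelianGroup.of_comm (TopologicalAbelianization F ⧸ i.2.toSubgroup)
  have hP : IsPGroup p (AffineGroup χ) := by
    refine AffineGroup.isPGroup (n := i.1) hQ ?_
    rw [← map_natCast (algebraMap (ZMod (p ^ i.1)) _), ZMod.natCast_self, map_zero]
  obtain ⟨φ, hφ, hφg⟩ := hg.exists_hom hP fun j => ⟨π (g j), c j⟩
  have hbase : (AffineGroup.baseHom χ).comp φ = π := by
    refine hg.hom_ext hQ ?_ ?_ fun j => ?_
    · filter_upwards [hφ] with y hy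
      have hy' : φ y = 1 := hy
      change (φ y).base = 1
      rw [hy']
      rfl
    · filter_upwards [i.2.preimageMk.isOpen'.mem_nhds i.2.preimageMk.one_mem'] with y hy
      exact (QuotientGroup.eq_one_iff _).mpr hy
    · change (φ (g j)).base = _
      rw [hφg]
  refine ⟨fun x => (φ x).vec, ⟨fun x y => ?_, ?_⟩, fun j => congrArg AffineGroup.vec (hφg j)⟩
  · have h : (φ y).base = π y := DFunLike.congr_fun hbase y
    rw [map_mul, AffineGroup.vec_mul, h]
    rfl
  · filter_upwards [hφ] with y hy
    have hy' : φ y = 1 := hy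
    rw [hy', AffineGroup.vec_one]

variable [DecidableEq ι]

/-- The Fox derivative with respect to the generator `g k`, at a finite level. -/
def foxDerivative (hg : IsFreeMetabelianProP p g) (k : ι)
    (i : ℕ × OpenNormalSubgroup (TopologicalAbelianization F)) :
    F → LevelAlgebra p (TopologicalAbelianization F) i :=
  (hg.exists_foxDerivation i (Pi.single k 1)).choose

lemma isFoxDerivation (hg : IsFreeMetabelianProP p g) (k : ι)
    (i : ℕ × OpenNormalSubgroup (TopologicalAbelianization F)) :
    IsFoxDerivation (hg.foxDerivative k i) :=
  (hg.exists_foxDerivation i (Pi.single k 1)).choose_spec.1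

lemma foxDerivative_apply (hg : IsFreeMetabelianProP p g) (k : ι)
    (i : ℕ × OpenNormalSubgroup (TopologicalAbelianization F)) (j : ι) :
    hg.foxDerivative k i (g j) = if j = k then 1 else 0 := by
  have h := (hg.exists_foxDerivation i (Pi.single k 1)).choose_spec.2 j
  rw [Pi.single_apply] at h
  exact h

/-- The derivatives are chosen separately at each level; uniqueness makes them compatible, so that
they define elements of the inverse limit R. -/
lemma levelMap_foxDerivative (hg : IsFreeMetabelianProP p g) (k : ι)
    {i j : ℕ × OpenNormalSubgroup (TopologicalAbelianization F)} (hn : i.1 ≤ j.1) (hN : j.2 ≤ i.2)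
    (x : F) : levelMap p hn hN (hg.foxDerivative k j x) = hg.foxDerivative k i x := by
  refine congrFun (hg.foxDerivation_ext ((hg.isFoxDerivation k j).levelMap hn hN)
    (hg.isFoxDerivation k i) fun l => ?_) x
  rw [foxDerivative_apply, foxDerivative_apply]
  split_ifs <;> simp

/-- The restriction of a Fox derivative to the derived subgroup, at a finite level. -/
def foxAddHom (hg : IsFreeMetabelianProP p g) (k : ι)
    (i : ℕ × OpenNormalSubgroup (TopologicalAbelianization F)) :
    DerivedModule F →+ LevelAlgebra p (TopologicalAbelianization F) i :=
  AddMonoidHom.mk' (fun a => hg.foxDerivative k i (a.toMul : F)) fun a b => by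
    rw [toMul_add, Subgroup.coe_mul, (hg.isFoxDerivation k i).map_mul,
      levelOf_eq_one i b.toMul.2, one_mul]

lemma foxAddHom_groupRingAct (hg : IsFreeMetabelianProP p g) (k : ι)
    (i : ℕ × OpenNormalSubgroup (TopologicalAbelianization F))
    (s : MonoidAlgebra ℤ (TopologicalAbelianization F)) (a : DerivedModule F) :
    hg.foxAddHom k i (groupRingAct s a) = toLevel p i s * hg.foxAddHom k i a := by
  induction s using MonoidAlgebra.induction_linear with
  | zero => simp
  | add s t hs ht => rw [groupRingAct_add, map_add, map_add, hs, ht, add_mul]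
  | single x n =>
    induction x using QuotientGroup.induction_on with | H x => ?_
    rw [groupRingAct_single, map_zsmul, toLevel_single, smul_mul_assoc]
    congr 1
    exact (hg.isFoxDerivation k i).map_conj x a.toMul.2

/-- A derivative at a fixed level vanishes near 0, so it does not distinguish `r • a` from the
action on a of an s ∈ ℤ[X] close enough to r; this reduces to the group ring. -/
lemma foxAddHom_smul (hg : IsFreeMetabelianProP p g) (k : ι)
    (i : ℕ × OpenNormalSubgroup (TopologicalAbelianization F))
    (r : AbelianizedAlgebra F p) (a : DerivedModule F) :
    hg.foxAddHom k i (r • a) = r.1 i * hg.foxAddHom k i a := by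
  have hV : {b : DerivedModule F | hg.foxAddHom k i b = 0} ∈ 𝓝 0 := by
    have hc : Filter.Tendsto (fun b : DerivedModule F => (b.toMul : F)) (𝓝 0) (𝓝 1) :=
      (continuous_subtype_val : Continuous fun b : derivedSubgroup F => (b : F)).tendsto 1
    exact hc.eventually (hg.isFoxDerivation k i).eventually
  obtain ⟨j, hj⟩ := isLimitSMul_smul p r a _ hV
  obtain ⟨l, hil, hjl⟩ := exists_level_le i j
  obtain ⟨s, hs⟩ := toLevel_surjective p l (r.1 l)
  have h : hg.foxAddHom k i (r • a - groupRingAct s a) = 0 :=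
    hj s (toLevel_eq_of_le p hjl.1 hjl.2 hs)
  rw [map_sub, sub_eq_zero, foxAddHom_groupRingAct, toLevel_eq_of_le p hil.1 hil.2 hs] at h
  exact h

/-- The Fox derivative with respect to the generator `g k`, as an `R`-linear map `F' → R`. -/
def foxLinearMap (hg : IsFreeMetabelianProP p g) (k : ι) :
    DerivedModule F →ₗ[AbelianizedAlgebra F p] AbelianizedAlgebra F p where
  toFun a := ⟨fun i => hg.foxAddHom k i a, fun _ _ hn hN => hg.levelMap_foxDerivative k hn hN _⟩
  map_add' a b := by
    ext1
    funext i
    exact map_add (hg.foxAddHom k i) a b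
  map_smul' r a := by
    ext1
    funext i
    exact hg.foxAddHom_smul k i r a

lemma foxLinearMap_derivedCommutator (hg : IsFreeMetabelianProP p g) (k i j : ι) :
    hg.foxLinearMap k (derivedCommutator (g i) (g j)) =
      xiElement p (g j) * (if i = k then 1 else 0) -
        xiElement p (g i) * (if j = k then 1 else 0) := by
  ext1
  funext l
  have h := (hg.isFoxDerivation k l).map_commutator (g i) (g j)
  rw [foxDerivative_apply, foxDerivative_apply, ← xiElement_val, ← xiElement_val] at h
  refine Eq.trans h ?_
  split_ifs <;> simp

end IsFreeMetabelianProP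

end

noncomputable section

/-! ### Injectivity of the Magnus embedding on F' -/

section AdditiveMaps

/-- The additive map `(ℤ/n)[Q] → M` with prescribed values on `Q`. -/
def MonoidAlgebra.liftZMod {n : ℕ} {Q M : Type*} [AddCommGroup M] (hM : ∀ m : M, n • m = 0)
    (f : Q → M) : MonoidAlgebra (ZMod n) Q →+ M :=
  (Finsupp.liftAddHom fun q => ZMod.lift n
    ⟨zmultiplesHom M (f q), by simpa using hM (f q)⟩).comp
      MonoidAlgebra.coeffAddEquiv.toAddMonoidHom

lemma MonoidAlgebra.liftZMod_single {n : ℕ} {Q M : Type*} [AddCommGroup M]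
    (hM : ∀ m : M, n • m = 0) (f : Q → M) (q : Q) :
    MonoidAlgebra.liftZMod hM f (MonoidAlgebra.single q 1) = f q := by
  have h : ZMod.lift n ⟨zmultiplesHom M (f q), by simpa using hM (f q)⟩ (1 : ZMod n) = f q := by
    have := ZMod.lift_coe n ⟨zmultiplesHom M (f q), by simpa using hM (f q)⟩ 1
    simpa using this
  simpa [MonoidAlgebra.liftZMod] using h

end AdditiveMaps

/-- The image in `F/F'` of an open normal subgroup of `F`. -/
def OpenNormalSubgroup.mapMk {F : Type u} [Group F] [TopologicalSpace F] [IsTopologicalGroup F]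
    (N : OpenNormalSubgroup F) : OpenNormalSubgroup (TopologicalAbelianization F) where
  toSubgroup := N.toSubgroup.map (QuotientGroup.mk' _)
  isOpen' := QuotientGroup.isOpenMap_coe _ N.isOpen'
  isNormal' := N.isNormal'.map _ (QuotientGroup.mk'_surjective _)

namespace IsFreeMetabelianProP

variable {p : ℕ} [Fact p.Prime] {ι : Type*} [Finite ι] {F : Type u} [Group F]
  [TopologicalSpace F] [IsTopologicalGroup F] [CompactSpace F] [T2Space F]
  [TotallyDisconnectedSpace F] [IsProP p F] [IsMetabelianGroup F] {g : ι → F} [DecidableEq ι]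

/-- An element of `F'` all of whose Fox derivatives vanish is in every open normal subgroup. -/
lemma mem_of_foxLinearMap_eq_zero (hg : IsFreeMetabelianProP p g) {a : DerivedModule F}
    (ha : ∀ k, hg.foxLinearMap k a = 0) (N : OpenNormalSubgroup F) :
    (a.toMul : F) ∈ N.toSubgroup := by
  have := Fintype.ofFinite ι
  let B : Subgroup (F ⧸ N.toSubgroup) :=
    (derivedSubgroup F).map (QuotientGroup.mk' N.toSubgroup)
  let instB : CommGroup B :=
    { (inferInstance : Group B) with
      mul_comm := by
        rintro ⟨_, x, hx, rfl⟩ ⟨_, y, hy, rfl⟩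
        have h := congrArg Subtype.val (mul_comm (⟨x, hx⟩ : derivedSubgroup F) ⟨y, hy⟩)
        exact Subtype.ext (congrArg (QuotientGroup.mk' N.toSubgroup) h) }
  obtain ⟨n, hn⟩ := IsProP.index_eq_pow (p := p) N
  have hB : ∀ b : Additive B, p ^ n • b = 0 := by
    intro b
    apply Additive.toMul.injective
    apply Subtype.ext
    change (b.toMul : F ⧸ N.toSubgroup) ^ (p ^ n) = 1
    rw [← hn, Subgroup.index, pow_card_eq_one']
  -- The level whose derivatives determine a modulo N: `p ^ n` kills B, so functions on Q = F/NF'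
  -- with values in B extend additively to (ℤ/pⁿ)[Q].
  let i : ℕ × OpenNormalSubgroup (TopologicalAbelianization F) := (n, N.mapMk)
  let π : F →* TopologicalAbelianization F ⧸ i.2.toSubgroup :=
    (QuotientGroup.mk' i.2.toSubgroup).comp (QuotientGroup.mk' (derivedSubgroup F))
  have hπ : Function.Surjective π :=
    (QuotientGroup.mk'_surjective _).comp (QuotientGroup.mk'_surjective _)
  have hπN : ∀ x ∈ N.toSubgroup, π x = 1 := fun x hx =>
    (QuotientGroup.eq_one_iff _).mpr ⟨x, hx, rfl⟩
  have hπB : ∀ x, π x = 1 → QuotientGroup.mk' N.toSubgroup x ∈ B := by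
    intro x hx
    obtain ⟨y, hy, hyx⟩ := (QuotientGroup.eq_one_iff _).mp hx
    refine ⟨y⁻¹ * x, QuotientGroup.eq.mp hyx, ?_⟩
    have hy1 : QuotientGroup.mk' N.toSubgroup y = 1 := (QuotientGroup.eq_one_iff _).mpr hy
    rw [map_mul, map_inv, hy1, inv_one, one_mul]
  let s := Function.surjInv hπ
  have hs : ∀ q, π (s q) = q := Function.surjInv_eq hπ
  -- The cocycle of the Kaloujnine–Krasner embedding of F/N into the wreath product of B by Q, for
  -- the section s.
  let κ : F → (TopologicalAbelianization F ⧸ i.2.toSubgroup) → Additive B := fun x q =>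
    Additive.ofMul ⟨QuotientGroup.mk' N.toSubgroup ((s (π x * q))⁻¹ * x * s q),
      hπB _ (by rw [map_mul, map_mul, map_inv, hs, hs]; group)⟩
  let ρ := fun k => MonoidAlgebra.liftZMod (n := p ^ i.1) hB (κ (g k))
  -- The crossed homomorphism rebuilt from Fox derivatives: as D_k(g_j) = δ_jk, it agrees with κ on
  -- the generators.
  let T : F → (TopologicalAbelianization F ⧸ i.2.toSubgroup) → Additive B := fun x q =>
    ∑ k, ρ k (MonoidAlgebra.single q 1 * hg.foxDerivative k i x)
  have hκ : ∀ x y q, κ (x * y) q = κ x (π y * q) + κ y q := by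
    intro x y q
    apply Additive.toMul.injective
    apply Subtype.ext
    change QuotientGroup.mk' N.toSubgroup ((s (π (x * y) * q))⁻¹ * (x * y) * s q) =
      QuotientGroup.mk' N.toSubgroup ((s (π x * (π y * q)))⁻¹ * x * s (π y * q)) *
        QuotientGroup.mk' N.toSubgroup ((s (π y * q))⁻¹ * y * s q)
    rw [← map_mul, map_mul π, mul_assoc (π x)]
    congr 1
    group
  have hT : ∀ x y q, T (x * y) q = T x (π y * q) + T y q := by
    intro x y q
    simp only [T]
    rw [← Finset.sum_add_distrib]
    refine Finset.sum_congr rfl fun k _ => ?_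
    have h : (MonoidAlgebra.single q 1 * levelOf p i y :
        LevelAlgebra p (TopologicalAbelianization F) i) = MonoidAlgebra.single (π y * q) 1 := by
      change MonoidAlgebra.single q 1 * MonoidAlgebra.single (π y) 1 = _
      rw [MonoidAlgebra.single_mul_single, one_mul, mul_comm]
    rw [(hg.isFoxDerivation k i).map_mul, mul_add, map_add, ← mul_assoc, h]
  -- Thus κ(a, 1) = Σ ρ_k(D_k a) = 0. Since π a = 1, κ(a, 1) is the class of a conjugate of a, so a
  -- ∈ N.
  have key := hg.crossedHom_ext π hT hκ ?_ ?_ (a.toMul : F) 1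
  · have hT0 : T (a.toMul : F) 1 = 0 := by
      refine Finset.sum_eq_zero fun k _ => ?_
      have h : hg.foxDerivative k i (a.toMul : F) = 0 :=
        congrFun (congrArg Subtype.val (ha k)) i
      rw [h, mul_zero, map_zero]
    rw [hT0] at key
    have h1 : QuotientGroup.mk' N.toSubgroup ((s (π (a.toMul : F) * 1))⁻¹ * a.toMul * s 1) = 1 :=
      (congrArg (fun b : Additive B => (b.toMul : F ⧸ N.toSubgroup)) key).symm
    have hπa : π (a.toMul : F) = 1 := by
      have h : QuotientGroup.mk' (derivedSubgroup F) (a.toMul : F) = 1 :=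
        (QuotientGroup.eq_one_iff _).mpr a.toMul.2
      change QuotientGroup.mk' i.2.toSubgroup (QuotientGroup.mk' (derivedSubgroup F) _) = 1
      rw [h, map_one]
    rw [hπa, one_mul] at h1
    have h2 : (s 1)⁻¹ * (a.toMul : F) * s 1 ∈ N.toSubgroup := (QuotientGroup.eq_one_iff _).mp h1
    have h3 := N.isNormal'.conj_mem _ h2 (s 1)
    convert h3 using 1
    group
  · have hD : ∀ᶠ x in 𝓝 (1 : F), ∀ k, hg.foxDerivative k i x = 0 :=
      Filter.eventually_all.mpr fun k => (hg.isFoxDerivation k i).eventually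
    filter_upwards [hD, N.isOpen'.mem_nhds N.one_mem'] with x hx hxN q
    have h1 : T x q = 0 := Finset.sum_eq_zero fun k _ => by rw [hx, mul_zero, map_zero]
    rw [h1]
    apply Additive.toMul.injective
    apply Subtype.ext
    change 1 = QuotientGroup.mk' N.toSubgroup ((s (π x * q))⁻¹ * x * s q)
    have h2 : QuotientGroup.mk' N.toSubgroup x = 1 := (QuotientGroup.eq_one_iff _).mpr hxN
    rw [hπN x hxN, one_mul, map_mul, map_mul, map_inv, h2, mul_one, inv_mul_cancel]
  · intro j q
    have h1 : T (g j) q = ρ j (MonoidAlgebra.single q 1) := by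
      simp only [T]
      rw [Finset.sum_eq_single j]
      · rw [foxDerivative_apply, if_pos rfl, mul_one]
      · intro k _ hk
        rw [foxDerivative_apply, if_neg hk.symm, mul_zero, map_zero]
      · simp
    rw [h1]
    exact MonoidAlgebra.liftZMod_single hB _ q

/-- The Fox derivatives embed `F'` into a free `R`-module. -/
lemma eq_zero_of_foxLinearMap_eq_zero (hg : IsFreeMetabelianProP p g) {a : DerivedModule F}
    (ha : ∀ k, hg.foxLinearMap k a = 0) : a = 0 := by
  apply Additive.toMul.injective
  apply Subtype.ext
  by_contra hne
  obtain ⟨N, hN⟩ := ProfiniteGrp.exist_openNormalSubgroup_sub_open_nhds_of_one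
    (isOpen_compl_singleton (x := (a.toMul : F))) (by simpa [eq_comm] using hne)
  exact hN (hg.mem_of_foxLinearMap_eq_zero ha N) rfl

end IsFreeMetabelianProP

end

noncomputable section

/-! ### The elements `x - 1` are not zero divisors -/

section NonZeroDivisor

/-- An element of `S[P]` invariant under `y` is a multiple of the norm of `y`, and so it vanishes in
`S[Q]` if `y` becomes trivial in `Q` and the order of `y` is zero in `S`. -/
lemma MonoidAlgebra.mapDomainRingHom_eq_zero {S P Q : Type*} [CommRing S] [CommGroup P] [Finite P]
    [CommGroup Q] (f : P →* Q) {y : P} (hy : f y = 1) (ho : (orderOf y : S) = 0)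
    {t : MonoidAlgebra S P} (ht : MonoidAlgebra.single y 1 * t = t) :
    MonoidAlgebra.mapDomainRingHom S f t = 0 := by
  classical
  have := Fintype.ofFinite P
  let H := Subgroup.zpowers y
  let V : Subgroup P :=
    { carrier := {h | ∀ a, t.coeff (h * a) = t.coeff a}
      mul_mem' := fun {h k} hh hk a => by rw [mul_assoc, hh, hk]
      one_mem' := fun a => by rw [one_mul]
      inv_mem' := fun {h} hh a => by rw [← hh, mul_inv_cancel_left] }
  have hyV : y ∈ V := fun a => by
    have h : (MonoidAlgebra.single y 1 * t).coeff (y * a) = t.coeff a := by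
      simp
    rw [ht] at h
    exact h
  have hHV : H ≤ V := (Subgroup.zpowers_le).mpr hyV
  have hHf : H ≤ f.ker := (Subgroup.zpowers_le).mpr hy
  have hsum : t = ∑ a : P, MonoidAlgebra.single a (t.coeff a) := by
    apply MonoidAlgebra.coeff_injective
    ext b
    simp
  have hmk : ∀ (q : P ⧸ H) (h : H), (QuotientGroup.mk (q.out * h) : P ⧸ H) = q := fun q h => by
    rw [QuotientGroup.mk_mul_of_mem _ h.2, QuotientGroup.out_eq']
  have hbij : Function.Bijective fun c : (P ⧸ H) × H => c.1.out * (c.2 : P) := by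
    refine ⟨fun c c' hc => ?_, fun a => ?_⟩
    · have h1 : c.1 = c'.1 := by rw [← hmk c.1 c.2, ← hmk c'.1 c'.2]; exact congrArg _ hc
      refine Prod.ext h1 (Subtype.ext ?_)
      simp only [h1] at hc
      exact mul_left_cancel hc
    · exact ⟨(QuotientGroup.mk a, ⟨_, QuotientGroup.eq.mp (QuotientGroup.out_eq' (a : P ⧸ H))⟩),
        mul_inv_cancel_left _ _⟩
  have hterm : ∀ (q : P ⧸ H) (h : H),
      MonoidAlgebra.single (f (q.out * h)) (t.coeff (q.out * h)) =
        MonoidAlgebra.single (f q.out) (t.coeff q.out) := fun q h => by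
    have h1 : f (h : P) = 1 := hHf h.2
    rw [map_mul, h1, mul_one, mul_comm, hHV h.2]
  have hcard : (Fintype.card H : S) = 0 := by
    rw [← Nat.card_eq_fintype_card, Nat.card_zpowers, ho]
  rw [hsum, map_sum]
  simp only [MonoidAlgebra.mapDomainRingHom_apply, MonoidAlgebra.mapDomain_single]
  -- Group the sum by cosets of H = ⟨y⟩. Coefficients and images under f are constant on each coset,
  -- which therefore contributes |H| = 0 times one term.
  rw [← hbij.sum_comp (fun a => MonoidAlgebra.single (f a) (t.coeff a)), Fintype.sum_prod_type]
  refine Finset.sum_eq_zero fun q _ => ?_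
  rw [Finset.sum_congr rfl fun h _ => hterm q h, Finset.sum_const, Finset.card_univ,
    MonoidAlgebra.smul_single, nsmul_eq_mul, hcard, zero_mul, MonoidAlgebra.single_zero]

end NonZeroDivisor

namespace IsFreeMetabelianProP

variable {p : ℕ} [Fact p.Prime] {ι : Type*} [Finite ι] {F : Type u} [Group F]
  [TopologicalSpace F] [IsTopologicalGroup F] [CompactSpace F] [T2Space F]
  [TotallyDisconnectedSpace F] [IsProP p F] [IsMetabelianGroup F] {g : ι → F}

/-- The images of the free generators in `F/F'` have infinite order. -/
lemma exists_dvd_of_pow_mem (hg : IsFreeMetabelianProP p g) (j : ι) (k : ℕ) :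
    ∃ N : OpenNormalSubgroup (TopologicalAbelianization F), ∀ m : ℕ,
      (QuotientGroup.mk (g j) : TopologicalAbelianization F) ^ m ∈ N.toSubgroup → p ^ k ∣ m := by
  have : NeZero (p ^ k) := ⟨pow_ne_zero _ (Fact.out : p.Prime).ne_zero⟩
  let G := ULift.{u} (Multiplicative (ZMod (p ^ k)))
  have hG : IsPGroup p G := by
    refine IsPGroup.of_card (n := k) ?_
    rw [Nat.card_ulift]
    exact Nat.card_zmod _
  have := IsMetabelianGroup.of_comm G
  -- Every generator is sent to 1 ∈ ℤ/p^k, lifted to the universe of F. The kernel contains F', and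
  -- its image in F/F' is the required subgroup.
  obtain ⟨φ, hφ, hφg⟩ := hg.exists_hom hG fun _ => ⟨Multiplicative.ofAdd 1⟩
  have hker : IsOpen (φ.ker : Set F) := φ.ker.isOpen_of_mem_nhds hφ
  have hle : derivedSubgroup F ≤ φ.ker :=
    Subgroup.topologicalClosure_minimal _ (Abelianization.commutator_subset_ker φ)
      (φ.ker.isClosed_of_isOpen hker)
  let N : OpenNormalSubgroup F := ⟨⟨φ.ker, hker⟩, inferInstance⟩
  refine ⟨N.mapMk, fun m hm => ?_⟩
  obtain ⟨x, hx, hxm⟩ := hm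
  have hx' : φ x = 1 := hx
  have h1 : φ (x⁻¹ * g j ^ m) = 1 := hle (QuotientGroup.eq.mp hxm)
  rw [map_mul, map_inv, hx', inv_one, one_mul, map_pow, hφg] at h1
  have h2 : (Multiplicative.ofAdd (1 : ZMod (p ^ k))) ^ m = 1 := congrArg ULift.down h1
  rw [← ofAdd_nsmul] at h2
  have h3 : m • (1 : ZMod (p ^ k)) = 0 := h2
  rwa [nsmul_one, ZMod.natCast_eq_zero_iff] at h3

/-- If x_j r = r, then at every level r is invariant under a power y of x_j that is trivial modulo
N. At a level deep enough for pⁿ to divide the order of y, r is a multiple of the norm of y, which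
vanishes on projection to (ℤ/pⁿ)[X/N]. -/
lemma eq_zero_of_xiElement_mul_eq_zero (hg : IsFreeMetabelianProP p g) (j : ι)
    {r : AbelianizedAlgebra F p} (hr : xiElement p (g j) * r = 0) : r = 0 := by
  apply Subtype.ext
  funext i
  obtain ⟨n, N⟩ := i
  obtain ⟨e, he⟩ := isPGroup_quotient_abelianization (p := p) N
    (QuotientGroup.mk (QuotientGroup.mk (g j) : TopologicalAbelianization F))
  -- The exponent is n + e because y = x^(p^e) loses a factor p^e of the order of x, and pⁿ must
  -- remain.
  obtain ⟨N', hN'⟩ := hg.exists_dvd_of_pow_mem j (n + e)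
  have hN : (N ⊓ N' : OpenNormalSubgroup (TopologicalAbelianization F)) ≤ N := inf_le_left
  rw [← r.2 (n, N) (n, N ⊓ N') le_rfl hN]
  set l : ℕ × OpenNormalSubgroup (TopologicalAbelianization F) := (n, N ⊓ N') with hl
  have h1 : levelOf p l (g j) * r.1 l = r.1 l := by
    have h : (xiElement p (g j)).1 l * r.1 l = 0 := congrFun (congrArg Subtype.val hr) l
    rw [xiElement_val, sub_mul, one_mul, sub_eq_zero] at h
    exact h
  have h2 : ∀ m : ℕ, levelOf p l (g j) ^ m * r.1 l = r.1 l := by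
    intro m
    induction m with
    | zero => simp
    | succ m ih => rw [pow_succ, mul_assoc, h1, ih]
  let x : TopologicalAbelianization F := QuotientGroup.mk (g j)
  let y : TopologicalAbelianization F ⧸ l.2.toSubgroup := QuotientGroup.mk (x ^ p ^ e)
  have h3 : (MonoidAlgebra.single y 1 : LevelAlgebra p _ l) * r.1 l = r.1 l := by
    have h := h2 (p ^ e)
    rw [← map_pow] at h
    exact h
  have hdvd : p ^ n ∣ orderOf y := by
    have h : y ^ orderOf y = 1 := pow_orderOf_eq_one y
    have h4 : (x ^ p ^ e) ^ orderOf y ∈ (N ⊓ N').toSubgroup := (QuotientGroup.eq_one_iff _).mp h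
    rw [← pow_mul] at h4
    have h5 := hN' _ h4.2
    rw [pow_add, mul_comm] at h5
    exact Nat.dvd_of_mul_dvd_mul_left (pow_pos (Fact.out : p.Prime).pos e) h5
  have h6 := MonoidAlgebra.mapDomainRingHom_eq_zero (S := ZMod (p ^ n))
    (QuotientGroup.map l.2.toSubgroup N.toSubgroup (MonoidHom.id _) hN) (y := y) he
    ((ZMod.natCast_eq_zero_iff _ _).mpr hdvd) h3
  change MonoidAlgebra.mapRingHom _ _ (MonoidAlgebra.mapDomainRingHom _ _ (r.1 l)) = 0
  rw [h6, map_zero]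

end IsFreeMetabelianProP

end

noncomputable section

/-! ### Finitely generated submodules are closed -/

section Closed

variable (p : ℕ) {X A : Type*} [CommGroup X] [TopologicalSpace X] [AddCommGroup A]
  [TopologicalSpace A] [DistribMulAction X A] [IsProPModule p X A] [IsTopologicalAddGroup A]
  [CompactSpace A] [T2Space A]

variable (X) in
-- This yields continuity of `r ↦ r • a`. An s ∈ ℤ[X] approximating r also vanishes at level i, so
-- both s·a and the error `r • a` − s·a lie in U.
lemma exists_level_smul_mem {V : Set A} (hV : V ∈ 𝓝 0) :
    ∃ i : ℕ × OpenNormalSubgroup X, ∀ r : CompletedGroupAlgebra p X, r.1 i = 0 →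
      ∀ a : A, r • a ∈ V := by
  obtain ⟨U, i, hU, hUV, -, hi⟩ := exists_level p X V hV
  refine ⟨i, fun r hr a => hUV ?_⟩
  obtain ⟨j, hj⟩ := (isLimitSMul_smul p r a).exists_approx p hU
  obtain ⟨l, hil, hjl⟩ := exists_level_le i j
  obtain ⟨s, hs⟩ := toLevel_surjective p l (r.1 l)
  have h1 := hj s (toLevel_eq_of_le p hjl.1 hjl.2 hs)
  have h2 := hi s 0 (by rw [toLevel_eq_of_le p hil.1 hil.2 hs, hr, map_zero]) a
  rw [map_zero, AddMonoid.End.zero_apply, sub_zero] at h2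
  simpa using U.add_mem h1 h2

variable [∀ i : ℕ × OpenNormalSubgroup X, Finite (LevelAlgebra p X i)]

/-- R is closed in a product of finite discrete rings, hence compact, and the submodule is the image
of R^κ under a continuous map. -/
lemma isClosed_iSup_span_singleton {κ : Type*} [Finite κ] (u : κ → A) :
    IsClosed ((⨆ k, Submodule.span (CompletedGroupAlgebra p X) {u k} :
      Submodule (CompletedGroupAlgebra p X) A) : Set A) := by
  have := Fintype.ofFinite κ
  let _ : ∀ i : ℕ × OpenNormalSubgroup X, TopologicalSpace (LevelAlgebra p X i) := fun _ => ⊥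
  have : ∀ i : ℕ × OpenNormalSubgroup X, DiscreteTopology (LevelAlgebra p X i) := fun _ => ⟨rfl⟩
  have hcl : IsClosed (completedGroupAlgebraSubring p X :
      Set (∀ i : ℕ × OpenNormalSubgroup X, LevelAlgebra p X i)) := by
    change IsClosed {r : ∀ i : ℕ × OpenNormalSubgroup X, LevelAlgebra p X i |
      ∀ (i j : ℕ × OpenNormalSubgroup X) (hn : i.1 ≤ j.1) (hN : j.2 ≤ i.2),
        levelMap p hn hN (r j) = r i}
    simp only [Set.ofPred_forall]
    refine isClosed_iInter fun i => isClosed_iInter fun j => isClosed_iInter fun hn =>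
      isClosed_iInter fun hN => isClosed_eq ?_ (continuous_apply i)
    exact continuous_of_discreteTopology.comp (continuous_apply j)
  have hcompact : CompactSpace (CompletedGroupAlgebra p X) :=
    isCompact_iff_compactSpace.mp hcl.isCompact
  have hsmul : ∀ a : A, Continuous fun r : CompletedGroupAlgebra p X => r • a := by
    intro a
    refine continuous_iff_continuousAt.mpr fun r V hV => ?_
    have hV' : (fun b => r • a + b) ⁻¹' V ∈ 𝓝 (0 : A) := by
      refine (continuous_const_add (r • a)).continuousAt.preimage_mem_nhds ?_
      rwa [add_zero]
    obtain ⟨i, hi⟩ := exists_level_smul_mem p X hV'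
    have hc : Continuous fun s : CompletedGroupAlgebra p X => s.1 i :=
      (continuous_apply i).comp continuous_subtype_val
    rw [Filter.mem_map]
    filter_upwards [hc.continuousAt.preimage_mem_nhds
      ((isOpen_discrete {r.1 i}).mem_nhds (Set.mem_singleton _))] with s hs
    have hs' : s.1 i = r.1 i := hs
    have h := hi (s - r) (sub_eq_zero.mpr hs') a
    rw [Set.mem_preimage, sub_smul, add_sub_cancel] at h
    exact h
  have hcont : Continuous fun c : κ → CompletedGroupAlgebra p X => ∑ k, c k • u k :=
    continuous_finsetSum _ fun k _ => (hsmul (u k)).comp (continuous_apply k)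
  convert (isCompact_range hcont).isClosed using 1
  ext a
  rw [← Submodule.span_range_eq_iSup, SetLike.mem_coe, Submodule.mem_span_range_iff_exists_fun]
  rfl

end Closed

/-! ### Generators of the derived subgroup -/

section Generators

variable {F : Type u} [Group F] [TopologicalSpace F] [IsTopologicalGroup F]

lemma continuous_derivedCommutator (x : F) :
    Continuous (derivedCommutator x : F → DerivedModule F) := by
  have h : Continuous fun y => x⁻¹ * y⁻¹ * x * y := by fun_prop
  exact h.subtype_mk _

lemma derivedCommutator_one (x : F) : derivedCommutator x 1 = 0 := by
  apply Additive.toMul.injective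
  apply Subtype.ext
  change x⁻¹ * 1⁻¹ * x * 1 = 1
  group

lemma derivedCommutator_self (x : F) : derivedCommutator x x = 0 := by
  apply Additive.toMul.injective
  apply Subtype.ext
  change x⁻¹ * x⁻¹ * x * x = 1
  group

lemma derivedCommutator_swap (x y : F) : derivedCommutator y x = -derivedCommutator x y := by
  apply Additive.toMul.injective
  apply Subtype.ext
  change y⁻¹ * x⁻¹ * y * x = (x⁻¹ * y⁻¹ * x * y)⁻¹
  group

variable [T2Space F] [IsMetabelianGroup F]

lemma derivedCommutator_mul (x y z : F) : derivedCommutator x (y * z) = derivedCommutator x z +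
    (QuotientGroup.mk z : TopologicalAbelianization F) • derivedCommutator x y := by
  apply Additive.toMul.injective
  apply Subtype.ext
  change x⁻¹ * (y * z)⁻¹ * x * (y * z) =
    (x⁻¹ * z⁻¹ * x * z) * (z⁻¹ * (x⁻¹ * y⁻¹ * x * y) * z)
  group

end Generators

namespace IsFreeMetabelianProP

variable {p : ℕ} [Fact p.Prime] {ι : Type*} [Finite ι] {F : Type u} [Group F]
  [TopologicalSpace F] [IsTopologicalGroup F] [CompactSpace F] [T2Space F]
  [TotallyDisconnectedSpace F] [IsProP p F] [IsMetabelianGroup F] {g : ι → F}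

/-- By `derivedCommutator_mul` and the X-stability of C, the y with [x, y] ∈ C form a closed
subgroup, which contains the generators. -/
lemma derivedCommutator_mem (hg : IsFreeMetabelianProP p g)
    {C : Submodule (AbelianizedAlgebra F p) (DerivedModule F)}
    (hC : IsClosed (C : Set (DerivedModule F))) {x : F}
    (h : ∀ k, derivedCommutator x (g k) ∈ C) (y : F) : derivedCommutator x y ∈ C := by
  have hsmul : ∀ (z : F), ∀ a ∈ C, (QuotientGroup.mk z : TopologicalAbelianization F) • a ∈ C :=
    fun z a ha => by
      rw [← of_smul p]
      exact C.smul_mem _ ha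
  let S : Subgroup F :=
    { carrier := {y | derivedCommutator x y ∈ C}
      mul_mem' := fun {y z} hy hz => by
        change derivedCommutator x (y * z) ∈ C
        rw [derivedCommutator_mul]
        exact C.add_mem hz (hsmul z _ hy)
      one_mem' := by
        change derivedCommutator x 1 ∈ C
        rw [derivedCommutator_one]
        exact C.zero_mem
      inv_mem' := fun {y} hy => by
        have h1 := derivedCommutator_mul x y y⁻¹
        rw [mul_inv_cancel, derivedCommutator_one] at h1
        change derivedCommutator x y⁻¹ ∈ C
        rw [eq_neg_of_add_eq_zero_left h1.symm]
        exact C.neg_mem (hsmul _ _ hy) }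
  exact hg.mem_of_isClosed (S := S) (hC.preimage (continuous_derivedCommutator x)) h y

/-- The commutators of the free generators generate `F'` topologically as an `R`-module. -/
lemma mem_of_derivedCommutator_mem (hg : IsFreeMetabelianProP p g)
    {C : Submodule (AbelianizedAlgebra F p) (DerivedModule F)}
    (hC : IsClosed (C : Set (DerivedModule F))) (h : ∀ i j, derivedCommutator (g i) (g j) ∈ C)
    (a : DerivedModule F) : a ∈ C := by
  have hall : ∀ x y : F, derivedCommutator x y ∈ C := by
    refine fun x y => hg.derivedCommutator_mem hC (fun k => ?_) y
    rw [derivedCommutator_swap]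
    exact C.neg_mem (hg.derivedCommutator_mem hC (h k) x)
  let S : Subgroup F :=
    (AddSubgroup.toSubgroup' C.toAddSubgroup).map (derivedSubgroup F).subtype
  have hS : IsClosed (S : Set F) :=
    (Subgroup.isClosed_topologicalClosure (commutator F)).isClosedEmbedding_subtypeVal.isClosedMap
      _ hC
  have hle : derivedSubgroup F ≤ S := by
    refine Subgroup.topologicalClosure_minimal _ ?_ hS
    rw [commutator_def, Subgroup.commutator_le]
    intro x _ y _
    -- `⁅x, y⁆` is x y x⁻¹ y⁻¹, which is [x⁻¹, y⁻¹] in the convention of `derivedCommutator`.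
    refine ⟨(derivedCommutator x⁻¹ y⁻¹).toMul, hall _ _, ?_⟩
    change x⁻¹⁻¹ * y⁻¹⁻¹ * x⁻¹ * y⁻¹ = _
    rw [inv_inv, inv_inv, commutatorElement_def]
  obtain ⟨b, hb, hba⟩ := hle a.toMul.2
  have : b = a.toMul := Subtype.ext hba
  rw [this] at hb
  exact hb

/-- The Hall–Witt identity for the free generators. -/
lemma xiElement_smul_derivedCommutator (hg : IsFreeMetabelianProP p g) (i j k : ι) :
    xiElement p (g k) • derivedCommutator (g i) (g j) =
      xiElement p (g j) • derivedCommutator (g i) (g k) -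
        xiElement p (g i) • derivedCommutator (g j) (g k) := by
  classical
  rw [← sub_eq_zero]
  -- Commutator calculus is avoided: both sides have the same Fox derivatives, an identity in the
  -- commutative ring R.
  refine hg.eq_zero_of_foxLinearMap_eq_zero fun l => ?_
  simp only [map_sub, map_smul, foxLinearMap_derivedCommutator, smul_eq_mul]
  ring

/-- Multiplication by ξ_j is injective on R, hence on F', which the derivatives embed in a free
module. -/
lemma xiElement_smul_eq_zero (hg : IsFreeMetabelianProP p g) (j : ι) {a : DerivedModule F}
    (ha : xiElement p (g j) • a = 0) : a = 0 := by
  classical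
  refine hg.eq_zero_of_foxLinearMap_eq_zero fun k => hg.eq_zero_of_xiElement_mul_eq_zero j ?_
  rw [← smul_eq_mul, ← map_smul, ha, map_zero]

end IsFreeMetabelianProP

lemma continuous_xiElement_smul {p : ℕ} {F : Type u} [Group F] [TopologicalSpace F]
    [IsTopologicalGroup F] [CompactSpace F] [T2Space F] [TotallyDisconnectedSpace F] [IsProP p F]
    [IsMetabelianGroup F] (x : F) :
    Continuous fun a : DerivedModule F => xiElement p x • a := by
  have h : ∀ a : DerivedModule F, xiElement p x • a =
      (QuotientGroup.mk x : TopologicalAbelianization F) • a - a := fun a => by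
    rw [xiElement, sub_smul, of_smul, one_smul]
  simp only [h]
  refine Continuous.sub ?_ continuous_id
  have hc : Continuous fun a : derivedSubgroup F => x⁻¹ * (a : F) * x := by fun_prop
  exact hc.subtype_mk _

end

/-! ### The theorem -/

theorem mainTheorem5 (p : ℕ) [Fact p.Prime] (d : ℕ) (hd : 2 ≤ d)
    {F : Type u} [Group F] [TopologicalSpace F] [IsTopologicalGroup F] [CompactSpace F]
    [T2Space F] [TotallyDisconnectedSpace F] [IsProP p F] [IsMetabelianGroup F]
    (g : Fin d → F) (hg : IsFreeMetabelianProP p g) :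
    (∃ e : DerivedModule F ≃ₗ[AbelianizedAlgebra F p] xiMultiples p (g ⟨d - 1, by omega⟩),
      ∀ a : DerivedModule F, (e a : DerivedModule F) = xiElement p (g ⟨d - 1, by omega⟩) • a) ∧
    LinearIndependent (AbelianizedAlgebra F p) (lastCommutators hd g) ∧
    xiMultiples p (g ⟨d - 1, by omega⟩) ≤
      ⨆ i : Fin (d - 1), Submodule.span (AbelianizedAlgebra F p) {lastCommutators hd g i} := by
  refine ⟨?_, ?_, ?_⟩
  · refine ⟨LinearEquiv.ofInjective (LinearMap.lsmul (AbelianizedAlgebra F p) (DerivedModule F)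
      (xiElement p (g ⟨d - 1, by omega⟩))) ?_, fun a => rfl⟩
    rw [← LinearMap.ker_eq_bot, LinearMap.ker_eq_bot']
    exact fun a ha => hg.xiElement_smul_eq_zero _ ha
  · rw [Fintype.linearIndependent_iff]
    intro c hc k
    -- For k other than the last index, D_k(u_id) = δ_ik ξ_d, so D_k isolates the k-th coefficient.
    have h := congrArg (hg.foxLinearMap (k.castLE (Nat.sub_le d 1))) hc
    rw [map_zero, map_sum, Finset.sum_eq_single k] at h
    · have hne : (⟨d - 1, by omega⟩ : Fin d) ≠ k.castLE (Nat.sub_le d 1) := fun h => by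
        have := congrArg Fin.val h
        simp at this
        omega
      rw [map_smul, lastCommutators, IsFreeMetabelianProP.foxLinearMap_derivedCommutator,
        if_pos rfl, if_neg hne, mul_one, mul_zero, sub_zero, smul_eq_mul, mul_comm] at h
      exact hg.eq_zero_of_xiElement_mul_eq_zero _ h
    · intro i _ hi
      have hne : (⟨d - 1, by omega⟩ : Fin d) ≠ k.castLE (Nat.sub_le d 1) := fun h => by
        have := congrArg Fin.val h
        simp at this
        omega
      have hne' : i.castLE (Nat.sub_le d 1) ≠ k.castLE (Nat.sub_le d 1) := fun h =>
        hi (Fin.castLE_injective _ h)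
      rw [map_smul, lastCommutators, IsFreeMetabelianProP.foxLinearMap_derivedCommutator,
        if_neg hne', if_neg hne, mul_zero, mul_zero, sub_zero, smul_zero]
    · simp
  · set U := ⨆ i : Fin (d - 1),
      Submodule.span (AbelianizedAlgebra F p) {lastCommutators hd g i} with hU
    -- The index i = d is included, where [g_d, g_d] = 0; the Hall–Witt identity below is used for
    -- all pairs i, j.
    have hlast : ∀ i : Fin d, derivedCommutator (g i) (g ⟨d - 1, by omega⟩) ∈ U := by
      intro i
      by_cases hi : (i : ℕ) < d - 1
      · exact (le_iSup (fun i : Fin (d - 1) => Submodule.span (AbelianizedAlgebra F p)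
          {lastCommutators hd g i}) ⟨i, hi⟩) (Submodule.mem_span_singleton_self _)
      · have : i = ⟨d - 1, by omega⟩ := Fin.ext (by have := i.2; simp; omega)
        rw [this, derivedCommutator_self]
        exact U.zero_mem
    let ξ := LinearMap.lsmul (AbelianizedAlgebra F p) (DerivedModule F)
      (xiElement p (g ⟨d - 1, by omega⟩))
    rintro _ ⟨a, rfl⟩
    have hUcl : IsClosed (U : Set (DerivedModule F)) := isClosed_iSup_span_singleton p _
    -- The a with aξ_d ∈ U form a closed submodule, so it is enough to test the commutators of
    -- generators.
    refine hg.mem_of_derivedCommutator_mem (C := U.comap ξ)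
      (hUcl.preimage (continuous_xiElement_smul _)) (fun i j => ?_) a
    change xiElement p (g ⟨d - 1, by omega⟩) • derivedCommutator (g i) (g j) ∈ U
    rw [hg.xiElement_smul_derivedCommutator]
    exact U.sub_mem (U.smul_mem _ (hlast i)) (U.smul_mem _ (hlast j))
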